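/- Let $\Lambda>0$ and let $f:\mathbb R\to\mathbb R$ be a Lipschitz continuous, $\Lambda$-periodic function (one fixed realization of the random surface). For $b>\max f$ put $$D=\{(x_1,x_2): 0<x_1<\Lambda,\ f(x_1)<x_2<b\},\quad S=\{(x_1,f(x_1)):0<x_1<\Lambda\},\quad \Gamma=\{(x_1,b):0<x_1<\Lambda\}.$$ For $k>0$ and an incidence angle $\theta\in(-\pi/2,\pi/2)$ put $\alpha=k\sin\theta$, $\beta=k\cos\theta$, and for $n\in\mathbb Z$ let $\alpha_n=\alpha+2\pi n/\Lambda$ and let $\beta_n$ be the square root of $k^2-\alpha_n^2$ which is nonnegative if $|\alpha_n|\le k$ and has positive imaginary part if $|\alpha_n|>k$. Let $H^1_{S,qp}(D)$ be the space of all $v\in H^1(D)$ whose trace vanishes on $S$ and satisfies $v(0,y)=v(\Lambda,y)e^{-i\alpha\Lambda}$ on the lateral sides of $D$. On $\Gamma$ define the Dirichlet-to-Neumann operator and the datum of the incident plane wave $e^{i\alpha x_1-i\beta x_2}$ by $$(Tv)(x_1)=\sum_{n\in\mathbb Z} i\beta_n v_n e^{i\alpha_n x_1},\quad v_n=\frac1\Lambda\int_0^\Lambda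 v(x_1,b)e^{-i\alpha_n x_1}\,dx_1,\qquad g(x_1)=-2i\beta e^{i\alpha x_1-i\beta b}.$$ The deterministic scattering problem $\Delta \tilde u+k^2\tilde u=0$ in $D$, $\tilde u=0$ on $S$, $\partial_{x_2}\tilde u=T\tilde u+g$ on $\Gamma$ is understood in its variational form: $\tilde u\in H^1_{S,qp}(D)$ and $$\int_D\nabla\tilde u\cdot\nabla\bar v-k^2\int_D\tilde u\bar v-\int_\Gamma (T\tilde u)\,\bar v=\int_\Gamma g\bar v\qquad\text{for all } v\in H^1_{S,qp}(D),$$ where $\int_\Gamma (T\tilde u)\bar v=\Lambda\sum_{n} i\beta_n \tilde u_n\overline{v_n}$. **Theorem (stability for the deterministic case).** There are constants $C>0$ and $k_0>0$, depending only on $\Lambda$ and $f$, such that for all $k\ge k_0$, all $b>1$ with $b>\max f$, all $\theta\in(-\pi/2,\pi/2)$ and all $\varepsilon>0$ with $|k-\alpha_n|\ge\varepsilon$ for every $n\in\mathbb Z$, every solution $\tilde u$ of the deterministic scattering problem satisfies $$\|\nabla\tilde u\|_{L^2(D)}+k\|\tilde u\|_{L^2(D)}\le C\max\Big\{\frac{b^2k^2}{\sqrt\varepsilon},\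 b^3k^{5/2}\Big\}\|g\|_{L^2(\Gamma)}.$$ -/

import Mathlib

open MeasureTheory Set
open scoped ContDiff ComplexConjugate

noncomputable section

namespace Grating

/-- One period of the domain between the surface `x₂ = f x₁` and the line `x₂ = b`. -/
def cell (Λ : ℝ) (f : ℝ → ℝ) (b : ℝ) : Set (ℝ × ℝ) :=
  {x | 0 < x.1 ∧ x.1 < Λ ∧ f x.1 < x.2 ∧ x.2 < b}

/-- `∂φ/∂x₁`. -/
def partial₁ (φ : ℝ × ℝ → ℂ) (x : ℝ × ℝ) : ℂ := fderiv ℝ φ x (1, 0)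

/-- `∂φ/∂x₂`. -/
def partial₂ (φ : ℝ × ℝ → ℂ) (x : ℝ × ℝ) : ℂ := fderiv ℝ φ x (0, 1)

/-- `v ∈ H¹(D)`, with weak gradient `(v₁, v₂)`. -/
structure MemH1 (D : Set (ℝ × ℝ)) (v v₁ v₂ : ℝ × ℝ → ℂ) : Prop where
  memLp : MemLp v 2 (volume.restrict D)
  memLp₁ : MemLp v₁ 2 (volume.restrict D)
  memLp₂ : MemLp v₂ 2 (volume.restrict D)
  weak₁ : ∀ φ : ℝ × ℝ → ℂ, ContDiff ℝ ∞ φ → HasCompactSupport φ → tsupport φ ⊆ D →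
    ∫ x in D, v x * partial₁ φ x = -∫ x in D, v₁ x * φ x
  weak₂ : ∀ φ : ℝ × ℝ → ℂ, ContDiff ℝ ∞ φ → HasCompactSupport φ → tsupport φ ⊆ D →
    ∫ x in D, v x * partial₂ φ x = -∫ x in D, v₂ x * φ x

/-- The values of `t` on the boundary of the cell are the trace of the function `v` with weak
gradient `(v₁, v₂)`: they are square integrable on the four pieces of the boundary, and Green's
formula holds against every smooth function, whether or not it vanishes on the boundary.
On the surface, the outer normal times the arc length element is `(f' x₁, -1) dx₁`. -/
structure IsTrace (Λ : ℝ) (f : ℝ → ℝ) (b : ℝ) (v v₁ v₂ t : ℝ × ℝ → ℂ) : Prop where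
  memLp_surface : MemLp (fun x => t (x, f x)) 2 (volume.restrict (Ioo 0 Λ))
  memLp_top : MemLp (fun x => t (x, b)) 2 (volume.restrict (Ioo 0 Λ))
  memLp_left : MemLp (fun y => t (0, y)) 2 (volume.restrict (Ioo (f 0) b))
  memLp_right : MemLp (fun y => t (Λ, y)) 2 (volume.restrict (Ioo (f Λ) b))
  green₁ : ∀ φ : ℝ × ℝ → ℂ, ContDiff ℝ ∞ φ → HasCompactSupport φ →
    ∫ x in cell Λ f b, (v x * partial₁ φ x + v₁ x * φ x) =
      (∫ x in Ioo 0 Λ, t (x, f x) * φ (x, f x) * ((deriv f x : ℝ) : ℂ))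
        + (∫ y in Ioo (f Λ) b, t (Λ, y) * φ (Λ, y))
        - ∫ y in Ioo (f 0) b, t (0, y) * φ (0, y)
  green₂ : ∀ φ : ℝ × ℝ → ℂ, ContDiff ℝ ∞ φ → HasCompactSupport φ →
    ∫ x in cell Λ f b, (v x * partial₂ φ x + v₂ x * φ x) =
      (∫ x in Ioo 0 Λ, t (x, b) * φ (x, b))
        - ∫ x in Ioo 0 Λ, t (x, f x) * φ (x, f x)

/-- `v ∈ H¹_{S,qp}(D)`, with weak gradient `(v₁, v₂)` and boundary trace `t`: the trace vanishes
on the surface, and `v(0, y) = v(Λ, y) exp(-i α Λ)` on the lateral sides. -/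
structure MemH1Sqp (Λ : ℝ) (f : ℝ → ℝ) (b α : ℝ) (v v₁ v₂ t : ℝ × ℝ → ℂ) : Prop where
  memH1 : MemH1 (cell Λ f b) v v₁ v₂
  isTrace : IsTrace Λ f b v v₁ v₂ t
  zero_on_surface : ∀ᵐ x ∂(volume.restrict (Ioo 0 Λ)), t (x, f x) = 0
  quasiperiodic : ∀ᵐ y ∂(volume.restrict (Ioo (f 0) b)),
    t (0, y) = t (Λ, y) * Complex.exp (-(Complex.I * α * Λ))

/-- `α_n = α + 2πn/Λ`. -/
def alphaN (Λ α : ℝ) (n : ℤ) : ℝ := α + 2 * Real.pi * n / Λ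

/-- `β_n`, the square root of `k² - α_n²` that is nonnegative or has positive imaginary part. -/
def betaN (Λ k α : ℝ) (n : ℤ) : ℂ :=
  if |alphaN Λ α n| ≤ k then (Real.sqrt (k ^ 2 - alphaN Λ α n ^ 2) : ℂ)
  else Complex.I * (Real.sqrt (alphaN Λ α n ^ 2 - k ^ 2) : ℂ)

/-- The Fourier coefficient `v_n` on `Γ` of a function with trace `t`. -/
def coeffN (Λ b α : ℝ) (t : ℝ × ℝ → ℂ) (n : ℤ) : ℂ :=
  (1 / Λ : ℂ) * ∫ x in Ioo 0 Λ, t (x, b) * Complex.exp (-(Complex.I * alphaN Λ α n * x))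

/-- `s = ∫_Γ (T u) conj(v)` for functions `u`, `v` with traces `t`, `r`, where
`T u = ∑ i β_n u_n exp(i α_n x₁)`. -/
def IsDtNPairing (Λ k b α : ℝ) (t r : ℝ × ℝ → ℂ) (s : ℂ) : Prop :=
  HasSum (fun n : ℤ =>
    (Λ : ℂ) * (Complex.I * betaN Λ k α n * coeffN Λ b α t n) * conj (coeffN Λ b α r n)) s

/-- The boundary datum `g(x₁) = -2iβ exp(iαx₁ - iβb)` of the incident wave
`exp(iαx₁ - iβx₂)`, where `α = k sin θ`, `β = k cos θ`. -/
def incidentData (k θ b : ℝ) (x : ℝ) : ℂ :=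
  -2 * Complex.I * (k * Real.cos θ : ℝ) *
    Complex.exp (Complex.I * (k * Real.sin θ : ℝ) * x - Complex.I * (k * Real.cos θ : ℝ) * b)

/-- `u ∈ H¹_{S,qp}(D)`, with weak gradient `(u₁, u₂)` and trace `t`, solves the deterministic
scattering problem in variational form:
`∫_D ∇u·∇conj(v) - k² ∫_D u conj(v) - ∫_Γ (T u) conj(v) = ∫_Γ g conj(v)`
for all `v ∈ H¹_{S,qp}(D)`. -/
structure IsSolution (Λ : ℝ) (f : ℝ → ℝ) (b k θ : ℝ) (u u₁ u₂ t : ℝ × ℝ → ℂ) : Prop where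
  mem : MemH1Sqp Λ f b (k * Real.sin θ) u u₁ u₂ t
  variational : ∀ v v₁ v₂ r : ℝ × ℝ → ℂ, MemH1Sqp Λ f b (k * Real.sin θ) v v₁ v₂ r →
    ∃ s : ℂ, IsDtNPairing Λ k b (k * Real.sin θ) t r s ∧
      (∫ x in cell Λ f b, (u₁ x * conj (v₁ x) + u₂ x * conj (v₂ x)))
        - (k : ℂ) ^ 2 * (∫ x in cell Λ f b, u x * conj (v x)) - s
      = ∫ x in Ioo 0 Λ, incidentData k θ b x * conj (r (x, b))

end Grating

end

/-! Write `N₀`, `N₁`, `N₂` for the squared `L²` norms of `u`, `u₁`, `u₂` on the cell, `c` for the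
minimum of `f`, and `r` for the modulus of `∫_Γ g conj(u)`. Testing the problem with `u` itself
gives `N₁ + N₂ - k² N₀ ≤ r` from the real part, since evanescent modes enter the
Dirichlet-to-Neumann pairing with a nonpositive sign, and `Λ ∑ Re β_n |u_n|² ≤ r` from the imaginary
part. A Rellich inequality (`integral_rellich_le`) gives `N₂ - N₁ + k² N₀ ≤ (b - c)(3kr + 2‖g‖²)`.
In the sum `N₁` and `k² N₀` cancel. Since `r ≤ ‖g‖ √(b - c) √N₂`, what remains is a quadratic
inequality for `√N₂`; the vertical Poincaré inequality then controls `N₀`, and the energy inequality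
controls the gradient (`stability_arith`). The resulting bound is of order `b³ k² ‖g‖`, which lies
below the second entry of the maximum.

The core is `rellich`. As `u` is only in `H¹`, the multiplier `m(x₂) ∂₂u` is not an admissible test
function. Instead `u` is extended by zero below the surface and lifted by the flow-like map `x₂ ↦ x₂
+ h m(x₂)` with `m ≥ 0` and `m b = 0`. Because the surface is a graph, the lifted function is again
admissible (`MemH1Sqp.pull`), and it has the same trace on the top as `u`. Testing with `u` and with
its lift therefore produces the same top terms, and comparing the two at first order in `h` leaves
`∫ m' (|u₂|² - |u₁|² + k²|u|²) ≤ 0`. The differences of gradients have a favourable sign, and the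
difference of the functions is `O(h)` in `L²` (`integral_displacement_le`), so that only an
inequality survives, which suffices.

The field `m` equals `x₂ - c` up to a height `M` above the surface. The correction lives in the flat
strip between `M` and `b`, where each Fourier mode solves a linear oscillator equation and conserves
`|U'|² + (k² - α_n²)|U|²` (`ae_mode_energy`). The strip thus contributes `b - c` times a series in
the Cauchy data on the top, which `mode_energy_le` bounds by the outgoing energy and the datum. -/

open scoped ENNReal

/-! ### Vertical changes of variable. -/

namespace Grating

/-- `ψ` is a smooth increasing change of the vertical variable, with inverse `φ` and with
derivative bounded above and bounded away from zero. -/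
structure IsStretch (ψ φ : ℝ → ℝ) : Prop where
  contDiff : ContDiff ℝ ∞ ψ
  left_inv : ∀ z, φ (ψ z) = z
  right_inv : ∀ y, ψ (φ y) = y
  measurable : Measurable φ
  lower : ∃ c, 0 < c ∧ ∀ z, c ≤ deriv ψ z
  upper : ∃ C, ∀ z, deriv ψ z ≤ C

namespace IsStretch

variable {ψ φ : ℝ → ℝ}

lemma deriv_pos (h : IsStretch ψ φ) (z : ℝ) : 0 < deriv ψ z := by
  obtain ⟨c, hc, h'⟩ := h.lower
  exact hc.trans_le (h' z)

lemma hasDerivAt (h : IsStretch ψ φ) (z : ℝ) : HasDerivAt ψ (deriv ψ z) z :=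
  (h.contDiff.differentiable (by simp) z).hasDerivAt

lemma contDiff_deriv (h : IsStretch ψ φ) : ContDiff ℝ ∞ (deriv ψ) := by
  have := h.contDiff
  rw [contDiff_infty_iff_deriv] at this
  exact this.2

lemma measurable_density (h : IsStretch ψ φ) :
    Measurable fun z => ENNReal.ofReal (deriv ψ z) :=
  h.contDiff_deriv.continuous.measurable.ennreal_ofReal

/-- The change of variables as a measurable equivalence of the line. -/
def equiv (h : IsStretch ψ φ) : ℝ ≃ᵐ ℝ where
  toFun := φ
  invFun := ψ
  left_inv := h.right_inv
  right_inv := h.left_inv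
  measurable_toFun := h.measurable
  measurable_invFun := h.contDiff.continuous.measurable

/-- The area formula for the smooth map `ψ` pushes the density `ψ'` to Lebesgue measure; inverting
the equivalence yields the claim for `φ`, without differentiating `φ`. -/
lemma measurePreserving (h : IsStretch ψ φ) :
    MeasurePreserving φ volume (volume.withDensity fun z => ENNReal.ofReal (deriv ψ z)) := by
  have key : Measure.map ψ (volume.withDensity fun z => ENNReal.ofReal (deriv ψ z)) = volume := by
    have := map_withDensity_abs_det_fderiv_eq_addHaar (volume : Measure ℝ) (s := univ) (f := ψ)
      (f' := fun z => ContinuousLinearMap.toSpanSingleton ℝ (deriv ψ z))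
      MeasurableSet.univ.nullMeasurableSet
      (fun x _ => (h.hasDerivAt x).hasFDerivAt.hasFDerivWithinAt)
      (Function.LeftInverse.injective h.left_inv).injOn
    have hsurj : ψ '' univ = univ := by
      rw [image_univ]; exact (Function.RightInverse.surjective h.right_inv).range_eq
    have e : (fun z => ENNReal.ofReal
        |(ContinuousLinearMap.toSpanSingleton ℝ (deriv ψ z)).det|) =
        fun z => ENNReal.ofReal (deriv ψ z) := by
      funext z
      rw [ContinuousLinearMap.det_toSpanSingleton, abs_of_pos (h.deriv_pos z)]
    rwa [hsurj, Measure.restrict_univ, e] at this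
  refine MeasurePreserving.symm h.equiv.symm ⟨h.contDiff.continuous.measurable, key⟩

lemma integral_comp (h : IsStretch ψ φ) {E : Type*} [NormedAddCommGroup E] [NormedSpace ℝ E]
    (F : ℝ → E) : ∫ y, F (φ y) = ∫ z, deriv ψ z • F z := by
  rw [h.measurePreserving.integral_comp h.equiv.measurableEmbedding,
    integral_withDensity_eq_integral_toReal_smul h.measurable_density (by simp)]
  simp [ENNReal.toReal_ofReal (h.deriv_pos _).le]

lemma memLp_comp (h : IsStretch ψ φ) {F : ℝ → ℂ} {p : ENNReal} (hF : MemLp F p volume) :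
    MemLp (fun y => F (φ y)) p volume := by
  obtain ⟨C, hC⟩ := h.upper
  refine MemLp.comp_measurePreserving (g := F) ?_ h.measurePreserving
  refine hF.of_measure_le_smul (c := ENNReal.ofReal C) (by simp) ?_
  rw [← withDensity_const]
  exact withDensity_mono (Filter.Eventually.of_forall fun z => ENNReal.ofReal_le_ofReal (hC _))

lemma quasiMeasurePreserving (h : IsStretch ψ φ) :
    Measure.QuasiMeasurePreserving φ volume volume :=
  ⟨h.measurable, by
    rw [h.measurePreserving.map_eq]; exact withDensity_absolutelyContinuous _ _⟩

lemma strictMono (h : IsStretch ψ φ) : StrictMono ψ := strictMono_of_deriv_pos h.deriv_pos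

lemma lt_iff (h : IsStretch ψ φ) {y z : ℝ} : φ y < z ↔ y < ψ z := by
  rw [← h.strictMono.lt_iff_lt, h.right_inv]

/-- The induced change of variables in the plane. -/
def equiv₂ (h : IsStretch ψ φ) : ℝ × ℝ ≃ᵐ ℝ × ℝ := (MeasurableEquiv.refl ℝ).prodCongr h.equiv

lemma measurePreserving₂ (h : IsStretch ψ φ) :
    MeasurePreserving (fun x : ℝ × ℝ => (x.1, φ x.2)) volume
      (volume.withDensity fun z : ℝ × ℝ => ENNReal.ofReal (deriv ψ z.2)) := by
  have := (MeasurePreserving.id (volume : Measure ℝ)).prod h.measurePreserving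
  rwa [prod_withDensity_right h.measurable_density] at this

lemma integral_comp₂ (h : IsStretch ψ φ) {E : Type*} [NormedAddCommGroup E] [NormedSpace ℝ E]
    (F : ℝ × ℝ → E) : ∫ x : ℝ × ℝ, F (x.1, φ x.2) = ∫ z : ℝ × ℝ, deriv ψ z.2 • F z := by
  rw [h.measurePreserving₂.integral_comp h.equiv₂.measurableEmbedding,
    integral_withDensity_eq_integral_toReal_smul
      (f := fun z : ℝ × ℝ => ENNReal.ofReal (deriv ψ z.2))
      (h.measurable_density.comp measurable_snd) (by simp)]
  simp [ENNReal.toReal_ofReal (h.deriv_pos _).le]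

lemma memLp_comp₂ (h : IsStretch ψ φ) {F : ℝ × ℝ → ℂ} {p : ENNReal} (hF : MemLp F p volume) :
    MemLp (fun x : ℝ × ℝ => F (x.1, φ x.2)) p volume := by
  obtain ⟨C, hC⟩ := h.upper
  refine MemLp.comp_measurePreserving (g := F) ?_ h.measurePreserving₂
  refine hF.of_measure_le_smul (c := ENNReal.ofReal C) (by simp) ?_
  rw [← withDensity_const]
  exact withDensity_mono (Filter.Eventually.of_forall fun z => ENNReal.ofReal_le_ofReal (hC _))

end IsStretch

end Grating

/-! ### Geometry of the cell and Green's formula without compact support. -/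

namespace Grating

variable {Λ b c α : ℝ} {f : ℝ → ℝ}

lemma isOpen_cell (hf : Continuous f) : IsOpen (cell Λ f b) := by
  have h1 : IsOpen {x : ℝ × ℝ | 0 < x.1} := isOpen_lt continuous_const continuous_fst
  have h2 : IsOpen {x : ℝ × ℝ | x.1 < Λ} := isOpen_lt continuous_fst continuous_const
  have h3 : IsOpen {x : ℝ × ℝ | f x.1 < x.2} :=
    isOpen_lt (hf.comp continuous_fst) continuous_snd
  have h4 : IsOpen {x : ℝ × ℝ | x.2 < b} := isOpen_lt continuous_snd continuous_const
  exact h1.inter (h2.inter (h3.inter h4))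

lemma measurableSet_cell (hf : Continuous f) : MeasurableSet (cell Λ f b) :=
  (isOpen_cell hf).measurableSet

lemma cell_subset (hc : ∀ x, c ≤ f x) : cell Λ f b ⊆ Ioo 0 Λ ×ˢ Ioo c b :=
  fun _ hx => ⟨⟨hx.1, hx.2.1⟩, (hc _).trans_lt hx.2.2.1, hx.2.2.2⟩

lemma volume_cell_lt_top (hc : ∀ x, c ≤ f x) : volume (cell Λ f b) < ⊤ := by
  refine (measure_mono (cell_subset hc)).trans_lt ?_
  rw [Measure.volume_eq_prod, Measure.prod_prod]
  simp [ENNReal.mul_lt_top]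

lemma continuous_partial₁ {φ : ℝ × ℝ → ℂ} (h : ContDiff ℝ ∞ φ) : Continuous (partial₁ φ) :=
  (h.continuous_fderiv (by simp)).clm_apply continuous_const

lemma continuous_partial₂ {φ : ℝ × ℝ → ℂ} (h : ContDiff ℝ ∞ φ) : Continuous (partial₂ φ) :=
  (h.continuous_fderiv (by simp)).clm_apply continuous_const

lemma hasDerivAt_partial₁ {φ : ℝ × ℝ → ℂ} {x : ℝ × ℝ} (h : DifferentiableAt ℝ φ x) :
    HasDerivAt (fun s => φ (s, x.2)) (partial₁ φ x) x.1 :=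
  HasFDerivAt.comp_hasDerivAt (l := φ) x.1 h.hasFDerivAt
    ((hasDerivAt_id x.1).prodMk (hasDerivAt_const x.1 x.2))

lemma hasDerivAt_partial₂ {φ : ℝ × ℝ → ℂ} {x : ℝ × ℝ} (h : DifferentiableAt ℝ φ x) :
    HasDerivAt (fun s => φ (x.1, s)) (partial₂ φ x) x.2 :=
  HasFDerivAt.comp_hasDerivAt (l := φ) x.2 h.hasFDerivAt
    ((hasDerivAt_const x.2 x.1).prodMk (hasDerivAt_id x.2))

/-- A smooth cutoff of a smooth function that leaves it unchanged near a bounded set. -/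
lemma exists_compact_cutoff (φ : ℝ × ℝ → ℂ) (hφ : ContDiff ℝ ∞ φ) (R : ℝ) :
    ∃ χ : ℝ × ℝ → ℂ, ContDiff ℝ ∞ χ ∧ HasCompactSupport χ ∧
      ∀ x : ℝ × ℝ, |x.1| ≤ R → |x.2| ≤ R →
        χ x = φ x ∧ partial₁ χ x = partial₁ φ x ∧ partial₂ χ x = partial₂ φ x := by
  -- The norm on the product is the maximum norm, so the inner ball contains the closed square of
  -- half-side `R`; `|R|` keeps the radii positive for every `R`.
  let ρ : ContDiffBump (0 : ℝ × ℝ) := ⟨|R| + 1, |R| + 2, by positivity, by linarith⟩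
  refine ⟨fun x => (ρ x : ℝ) • φ x, ρ.contDiff.smul hφ, ρ.hasCompactSupport.smul_right, ?_⟩
  intro x h1 h2
  have hx : x ∈ Metric.ball (0 : ℝ × ℝ) ρ.rIn := by
    rw [mem_ball_zero_iff, Prod.norm_def]
    refine max_lt ?_ ?_
    · exact (h1.trans (le_abs_self R)).trans_lt (lt_add_one _)
    · exact (h2.trans (le_abs_self R)).trans_lt (lt_add_one _)
  have he : (fun x => (ρ x : ℝ) • φ x) =ᶠ[nhds x] φ := by
    filter_upwards [ρ.eventuallyEq_one_of_mem_ball hx] with y hy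
    simp [hy]
  refine ⟨he.self_of_nhds, ?_, ?_⟩
  · simp only [partial₁, he.fderiv_eq]
  · simp only [partial₂, he.fderiv_eq]

section green

variable {v v₁ v₂ t : ℝ × ℝ → ℂ}

/-- A cutoff equal to one on a neighbourhood of the closed cell changes no term of Green's formula.
This admits test functions that extend to infinity, such as plane waves and primitives. -/
lemma IsTrace.green₁_smooth (hc : ∀ x, c ≤ f x) (hb : ∀ x, f x < b) (hΛ : 0 < Λ)
    (hf : Continuous f)
    (h : IsTrace Λ f b v v₁ v₂ t) {φ : ℝ × ℝ → ℂ} (hφ : ContDiff ℝ ∞ φ) :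
    ∫ x in cell Λ f b, (v x * partial₁ φ x + v₁ x * φ x) =
      (∫ x in Ioo 0 Λ, t (x, f x) * φ (x, f x) * ((deriv f x : ℝ) : ℂ))
        + (∫ y in Ioo (f Λ) b, t (Λ, y) * φ (Λ, y))
        - ∫ y in Ioo (f 0) b, t (0, y) * φ (0, y) := by
  obtain ⟨χ, h1, h2, h3⟩ := exists_compact_cutoff φ hφ (max Λ (max |c| |b|))
  have bd1 : ∀ x, 0 ≤ x → x ≤ Λ → |x| ≤ max Λ (max |c| |b|) := fun x hx hx' => by
    rw [abs_of_nonneg hx]; exact hx'.trans (le_max_left _ _)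
  have bd2 : ∀ y, c ≤ y → y ≤ b → |y| ≤ max Λ (max |c| |b|) := fun y hy hy' =>
    (abs_le_max_abs_abs hy hy').trans (le_max_right _ _)
  have := h.green₁ χ h1 h2
  have e1 : ∫ x in cell Λ f b, (v x * partial₁ χ x + v₁ x * χ x) =
      ∫ x in cell Λ f b, (v x * partial₁ φ x + v₁ x * φ x) := by
    refine setIntegral_congr_fun (measurableSet_cell hf) fun x hx => ?_
    obtain ⟨a1, a2, -⟩ := h3 x (bd1 _ hx.1.le hx.2.1.le)
      (bd2 _ ((hc _).trans hx.2.2.1.le) hx.2.2.2.le)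
    simp only [a1, a2]
  rw [e1] at this
  rw [this]
  congr 1
  · congr 1
    · refine setIntegral_congr_fun measurableSet_Ioo fun x hx => ?_
      rw [(h3 (x, f x) (bd1 _ hx.1.le hx.2.le) (bd2 _ (hc _) (hb _).le)).1]
    · refine setIntegral_congr_fun measurableSet_Ioo fun y hy => ?_
      rw [(h3 (Λ, y) (bd1 _ hΛ.le le_rfl) (bd2 _ ((hc _).trans hy.1.le) hy.2.le)).1]
  · refine setIntegral_congr_fun measurableSet_Ioo fun y hy => ?_
    rw [(h3 (0, y) (bd1 _ le_rfl hΛ.le) (bd2 _ ((hc _).trans hy.1.le) hy.2.le)).1]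

lemma IsTrace.green₂_smooth (hc : ∀ x, c ≤ f x) (hb : ∀ x, f x < b)
    (hf : Continuous f)
    (h : IsTrace Λ f b v v₁ v₂ t) {φ : ℝ × ℝ → ℂ} (hφ : ContDiff ℝ ∞ φ) :
    ∫ x in cell Λ f b, (v x * partial₂ φ x + v₂ x * φ x) =
      (∫ x in Ioo 0 Λ, t (x, b) * φ (x, b))
        - ∫ x in Ioo 0 Λ, t (x, f x) * φ (x, f x) := by
  obtain ⟨χ, h1, h2, h3⟩ := exists_compact_cutoff φ hφ (max Λ (max |c| |b|))
  have bd1 : ∀ x, 0 ≤ x → x ≤ Λ → |x| ≤ max Λ (max |c| |b|) := fun x hx hx' => by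
    rw [abs_of_nonneg hx]; exact hx'.trans (le_max_left _ _)
  have bd2 : ∀ y, c ≤ y → y ≤ b → |y| ≤ max Λ (max |c| |b|) := fun y hy hy' =>
    (abs_le_max_abs_abs hy hy').trans (le_max_right _ _)
  have := h.green₂ χ h1 h2
  have e1 : ∫ x in cell Λ f b, (v x * partial₂ χ x + v₂ x * χ x) =
      ∫ x in cell Λ f b, (v x * partial₂ φ x + v₂ x * φ x) := by
    refine setIntegral_congr_fun (measurableSet_cell hf) fun x hx => ?_
    obtain ⟨a1, -, a2⟩ := h3 x (bd1 _ hx.1.le hx.2.1.le)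
      (bd2 _ ((hc _).trans hx.2.2.1.le) hx.2.2.2.le)
    simp only [a1, a2]
  rw [e1] at this
  rw [this]
  congr 1
  · refine setIntegral_congr_fun measurableSet_Ioo fun x hx => ?_
    rw [(h3 (x, b) (bd1 _ hx.1.le hx.2.le) (bd2 _ ((hc x).trans (hb x).le) le_rfl)).1]
  · refine setIntegral_congr_fun measurableSet_Ioo fun x hx => ?_
    rw [(h3 (x, f x) (bd1 _ hx.1.le hx.2.le) (bd2 _ (hc _) (hb _).le)).1]

/-- Green's formula implies the definition of the weak gradient. -/
lemma IsTrace.memH1 (hc : ∀ x, c ≤ f x)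
    (hv : MemLp v 2 (volume.restrict (cell Λ f b)))
    (hv₁ : MemLp v₁ 2 (volume.restrict (cell Λ f b)))
    (hv₂ : MemLp v₂ 2 (volume.restrict (cell Λ f b)))
    (h : IsTrace Λ f b v v₁ v₂ t) : MemH1 (cell Λ f b) v v₁ v₂ := by
  have : IsFiniteMeasure (volume.restrict (cell Λ f b)) :=
    ⟨by simpa using volume_cell_lt_top hc⟩
  have hz : ∀ φ : ℝ × ℝ → ℂ, tsupport φ ⊆ cell Λ f b → ∀ x, x ∉ cell Λ f b → φ x = 0 :=
    fun φ hφ x hx => image_eq_zero_of_notMem_tsupport fun h => hx (hφ h)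
  have hint : ∀ w φ : ℝ × ℝ → ℂ, MemLp w 2 (volume.restrict (cell Λ f b)) → Continuous φ →
      HasCompactSupport φ → Integrable (fun x => w x * φ x) (volume.restrict (cell Λ f b)) := by
    intro w φ hw hφ hφc
    obtain ⟨C, hC⟩ := hφc.exists_bound_of_continuous hφ
    exact (hw.integrable (by norm_num)).mul_bdd hφ.aestronglyMeasurable
      (Filter.Eventually.of_forall hC)
  refine ⟨hv, hv₁, hv₂, fun φ h1 h2 h3 => ?_, fun φ h1 h2 h3 => ?_⟩
  · have := h.green₁ φ h1 h2
    have s1 : ∀ x, φ (x, f x) = 0 := fun x => hz φ h3 _ fun hx => lt_irrefl _ hx.2.2.1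
    have s2 : ∀ y, φ (Λ, y) = 0 := fun x => hz φ h3 _ fun hx => lt_irrefl _ hx.2.1
    have s3 : ∀ y, φ (0, y) = 0 := fun x => hz φ h3 _ fun hx => lt_irrefl _ hx.1
    simp only [s1, s2, s3, mul_zero, zero_mul, integral_zero, add_zero, sub_zero] at this
    rw [integral_add (hint _ (partial₁ φ) hv (continuous_partial₁ h1)
      (h2.fderiv_apply ℝ _)) (hint _ _ hv₁ h1.continuous h2)] at this
    exact eq_neg_of_add_eq_zero_left this
  · have := h.green₂ φ h1 h2
    have s1 : ∀ x, φ (x, f x) = 0 := fun x => hz φ h3 _ fun hx => lt_irrefl _ hx.2.2.1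
    have s2 : ∀ x, φ (x, b) = 0 := fun x => hz φ h3 _ fun hx => lt_irrefl _ hx.2.2.2
    simp only [s1, s2, mul_zero, integral_zero, sub_zero] at this
    rw [integral_add (hint _ (partial₂ φ) hv (continuous_partial₂ h1)
      (h2.fderiv_apply ℝ _)) (hint _ _ hv₂ h1.continuous h2)] at this
    exact eq_neg_of_add_eq_zero_left this

end green

end Grating

/-! ### Lifting a function that vanishes on the surface. -/

namespace Grating

variable {Λ b c α : ℝ} {f : ℝ → ℝ} {ψ φ : ℝ → ℝ}

/-- Extension of a trace by zero below the surface. -/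
noncomputable def extendTrace (f : ℝ → ℝ) (t : ℝ × ℝ → ℂ) (x : ℝ × ℝ) : ℂ :=
  open Classical in if f x.1 < x.2 then t x else 0

/-- The extension of `u` by zero, composed with the vertical change of variables. -/
noncomputable def pull (Λ : ℝ) (f : ℝ → ℝ) (b : ℝ) (φ : ℝ → ℝ) (u : ℝ × ℝ → ℂ) (x : ℝ × ℝ) : ℂ :=
  (cell Λ f b).indicator u (x.1, φ x.2)

/-- The change of variables moves upwards and fixes the top of the cell. -/
structure IsLift (f : ℝ → ℝ) (b : ℝ) (ψ φ : ℝ → ℝ) : Prop where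
  isStretch : IsStretch ψ φ
  fix : ψ b = b
  le : ∀ x z, f x < z → z ≤ ψ z

/-- `φ` moves points down as long as they stay above the surface and fixes height `b`, and the part
of the cell's closed column above a given point remains in the cell up to `b`. Hence the lifted
function is supported in the same cell. -/
lemma IsLift.mem_cell (h : IsLift f b ψ φ) {x : ℝ × ℝ} (hx : (x.1, φ x.2) ∈ cell Λ f b) :
    x ∈ cell Λ f b := by
  obtain ⟨h1, h2, h3, h4⟩ := hx
  refine ⟨h1, h2, ?_, ?_⟩
  · have := h.le _ _ h3
    rw [h.isStretch.right_inv] at this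
    exact lt_of_lt_of_le h3 this
  · have := h.isStretch.lt_iff.1 h4
    rwa [h.fix] at this

lemma IsLift.φ_top (h : IsLift f b ψ φ) : φ b = b := by
  conv_lhs => rw [← h.fix]
  exact h.isStretch.left_inv b

lemma pull_eq_zero (h : IsLift f b ψ φ) (u : ℝ × ℝ → ℂ) {x : ℝ × ℝ} (hx : x ∉ cell Λ f b) :
    pull Λ f b φ u x = 0 :=
  indicator_of_notMem (fun h' => hx (h.mem_cell h')) _

/-- Both integrands vanish off the cell, so the formula is the change of variables on the whole
plane, with Jacobian `deriv ψ z.2` moved onto the test functions. -/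
lemma IsLift.setIntegral_pull (h : IsLift f b ψ φ) (hf : Continuous f) (u w : ℝ × ℝ → ℂ)
    (p q : ℝ × ℝ → ℂ) :
    ∫ x in cell Λ f b, (pull Λ f b φ u x * p x + pull Λ f b φ w x * q x) =
      ∫ z in cell Λ f b, (u z * (deriv ψ z.2 * p (z.1, ψ z.2)) +
        w z * (deriv ψ z.2 * q (z.1, ψ z.2))) := by
  rw [setIntegral_eq_integral_of_forall_compl_eq_zero fun x hx => by
    simp [pull_eq_zero h _ hx]]
  have := h.isStretch.integral_comp₂ (fun z => (cell Λ f b).indicator u z * p (z.1, ψ z.2) +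
    (cell Λ f b).indicator w z * q (z.1, ψ z.2))
  simp only [h.isStretch.right_inv] at this
  rw [← integral_indicator (measurableSet_cell hf)]
  refine this.trans (integral_congr_ae (Filter.Eventually.of_forall fun z => ?_))
  by_cases hz : z ∈ cell Λ f b
  · simp only [indicator_of_mem hz, Complex.real_smul]; ring
  · simp [indicator_of_notMem hz]

lemma IsLift.lateral (h : IsLift f b ψ φ) (t : ℝ × ℝ → ℂ) (a : ℝ) (χ : ℝ → ℂ) :
    ∫ y in Ioo (f a) b, extendTrace f t (a, φ y) * χ y =
      ∫ z in Ioo (f a) b, t (a, z) * (deriv ψ z * χ (ψ z)) := by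
  have := h.isStretch.integral_comp (fun z => (Ioo (f a) b).indicator (fun z => t (a, z)) z * χ (ψ z))
  simp only [h.isStretch.right_inv] at this
  rw [← integral_indicator measurableSet_Ioo, ← integral_indicator measurableSet_Ioo]
  refine Eq.trans ?_ (this.trans ?_) <;>
    refine integral_congr_ae (Filter.Eventually.of_forall fun z => ?_)
  · simp only [extendTrace]
    by_cases h1 : f a < φ z
    · have hz : f a < z := by
        have := h.le _ _ h1
        rw [h.isStretch.right_inv] at this
        exact h1.trans_le this
      by_cases h2 : z < b
      · have h3 : φ z < b := by rwa [h.isStretch.lt_iff, h.fix]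
        rw [indicator_of_mem (show z ∈ Ioo (f a) b from ⟨hz, h2⟩),
          indicator_of_mem (show φ z ∈ Ioo (f a) b from ⟨h1, h3⟩), if_pos h1]
      · have h3 : ¬ φ z < b := by rwa [h.isStretch.lt_iff, h.fix]
        rw [indicator_of_notMem fun h' => h2 h'.2, indicator_of_notMem fun h' => h3 h'.2, zero_mul]
    · rw [indicator_of_notMem (s := Ioo (f a) b) (a := φ z) fun h' => h1 h'.1]
      simp [h1]
  · by_cases hz : z ∈ Ioo (f a) b
    · simp only [indicator_of_mem hz, Complex.real_smul]; ring
    · simp [indicator_of_notMem hz]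

lemma memLp_pull (h : IsStretch ψ φ) (hf : Continuous f) {u : ℝ × ℝ → ℂ}
    (hu : MemLp u 2 (volume.restrict (cell Λ f b))) : MemLp (pull Λ f b φ u) 2 volume :=
  h.memLp_comp₂ ((memLp_indicator_iff_restrict (measurableSet_cell hf)).2 hu)

lemma memLp_lateral (h : IsLift f b ψ φ) {t : ℝ × ℝ → ℂ} {a : ℝ}
    (ht : MemLp (fun y => t (a, y)) 2 (volume.restrict (Ioo (f a) b))) :
    MemLp (fun y => extendTrace f t (a, φ y)) 2 (volume.restrict (Ioo (f a) b)) := by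
  have := (h.isStretch.memLp_comp
    ((memLp_indicator_iff_restrict measurableSet_Ioo).2 ht)).restrict (Ioo (f a) b)
  refine this.ae_eq ?_
  filter_upwards [ae_restrict_mem measurableSet_Ioo] with y hy
  have h3 : φ y < b := by rw [h.isStretch.lt_iff, h.fix]; exact hy.2
  by_cases h1 : f a < φ y
  · rw [indicator_of_mem (show φ y ∈ Ioo (f a) b from ⟨h1, h3⟩)]
    simp [extendTrace, h1]
  · rw [indicator_of_notMem fun h' => h1 h'.1]
    simp [extendTrace, h1]

/-- The extension of a function of `H¹_{S,qp}` by zero, moved upwards, is in `H¹_{S,qp}`. -/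
theorem MemH1Sqp.pull (hf : Continuous f) (hc : ∀ x, c ≤ f x) (hb : ∀ x, f x < b) (hΛ : 0 < Λ)
    (hper : f Λ = f 0) (hl : IsLift f b ψ φ) {u u₁ u₂ t : ℝ × ℝ → ℂ}
    (hu : MemH1Sqp Λ f b α u u₁ u₂ t) :
    MemH1Sqp Λ f b α (pull Λ f b φ u) (pull Λ f b φ u₁)
      (pull Λ f b φ fun z => u₂ z / deriv ψ z.2)
      (fun x => extendTrace f t (x.1, φ x.2)) := by
  have hs := hl.isStretch
  -- A surface point is the image of a point at or below the surface, where the extension is zero;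
  -- hence the lifted trace vanishes on the surface.
  have hfφ : ∀ x, ¬ f x < φ (f x) := fun x h => by
    have := hl.le _ _ h
    rw [hs.right_inv] at this
    exact absurd h (not_lt.2 this)
  have hT : ∀ x, extendTrace f t (x, φ (f x)) = 0 := fun x => by simp [extendTrace, hfφ]
  have hTb : ∀ x, extendTrace f t (x, φ b) = t (x, b) := fun x => by
    simp [extendTrace, hl.φ_top, hb]
  -- The chain rule gives the vertical derivative the factor `1 / ψ'`, which is bounded because `ψ'`
  -- is bounded below.
  have hu2 : MemLp (fun z : ℝ × ℝ => u₂ z / deriv ψ z.2) 2 (volume.restrict (cell Λ f b)) := by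
    obtain ⟨a, ha, ha'⟩ := hs.lower
    refine (hu.memH1.memLp₂).of_le_mul (c := a⁻¹) ?_ ?_
    · have := (Complex.continuous_ofReal.comp
        (hs.contDiff_deriv.continuous.comp continuous_snd)).measurable.inv.aestronglyMeasurable
        (μ := volume.restrict (cell Λ f b))
      simp only [div_eq_mul_inv]; exact hu.memH1.memLp₂.1.mul this
    · refine Filter.Eventually.of_forall fun z => ?_
      rw [norm_div, div_eq_inv_mul, Complex.norm_real, Real.norm_of_nonneg (hs.deriv_pos _).le]
      gcongr
      exact ha' _
  have htr : IsTrace Λ f b (Grating.pull Λ f b φ u) (Grating.pull Λ f b φ u₁)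
      (Grating.pull Λ f b φ fun z => u₂ z / deriv ψ z.2)
      (fun x => extendTrace f t (x.1, φ x.2)) := by
    have hsurf : ∀ᵐ x ∂(volume.restrict (Ioo 0 Λ)), ∀ z : ℂ, t (x, f x) * z = 0 := by
      filter_upwards [hu.zero_on_surface] with x hx z
      simp [hx]
    have hψ' : ContDiff ℝ ∞ fun z : ℝ × ℝ => ((deriv ψ z.2 : ℝ) : ℂ) :=
      Complex.ofRealCLM.contDiff.comp (hs.contDiff_deriv.comp contDiff_snd)
    have hΨ : ContDiff ℝ ∞ fun z : ℝ × ℝ => (z.1, ψ z.2) :=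
      contDiff_fst.prodMk (hs.contDiff.comp contDiff_snd)
    refine ⟨?_, ?_, memLp_lateral hl hu.isTrace.memLp_left,
      memLp_lateral hl hu.isTrace.memLp_right, ?_, ?_⟩
    · simp only [hT]; exact MemLp.zero
    · simp only [hTb]; exact hu.isTrace.memLp_top
    · intro χ h1 h2
      rw [hl.setIntegral_pull hf]
      -- The original Green formula is tested with the transported function times the Jacobian; the
      -- Jacobian depends on `x₂` only and passes through `∂₁`.
      have hχ : ContDiff ℝ ∞ fun z : ℝ × ℝ => ((deriv ψ z.2 : ℝ) : ℂ) * χ (z.1, ψ z.2) :=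
        hψ'.mul (h1.comp hΨ)
      have hp : ∀ z : ℝ × ℝ, partial₁ (fun z : ℝ × ℝ => ((deriv ψ z.2 : ℝ) : ℂ) * χ (z.1, ψ z.2)) z =
          deriv ψ z.2 * partial₁ χ (z.1, ψ z.2) := fun z =>
        (hasDerivAt_partial₁ (hχ.differentiable (by simp) z)).unique
          ((hasDerivAt_partial₁ (h1.differentiable (by simp) (z.1, ψ z.2))).const_mul
            ((deriv ψ z.2 : ℝ) : ℂ))
      have := hu.isTrace.green₁_smooth hc hb hΛ hf hχ
      simp only [hp] at this
      rw [this]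
      simp only [hT]
      rw [hl.lateral t Λ fun y => χ (Λ, y), hl.lateral t 0 fun y => χ (0, y)]
      congr 2
      rw [integral_congr_ae (g := fun _ => 0), integral_zero]
      · simp
      · filter_upwards [hsurf] with x hx
        simp [hx]
    · intro χ h1 h2
      rw [hl.setIntegral_pull hf]
      -- Here the Jacobian must not be included: `∂₂` of the transported function already produces
      -- it.
      have hχ : ContDiff ℝ ∞ fun z : ℝ × ℝ => χ (z.1, ψ z.2) := h1.comp hΨ
      have hp : ∀ z : ℝ × ℝ, partial₂ (fun z : ℝ × ℝ => χ (z.1, ψ z.2)) z =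
          deriv ψ z.2 * partial₂ χ (z.1, ψ z.2) := fun z => by
        have := (hasDerivAt_partial₂ (h1.differentiable (by simp) (z.1, ψ z.2))).scomp z.2
          (hs.hasDerivAt z.2)
        refine (hasDerivAt_partial₂ (hχ.differentiable (by simp) z)).unique ?_
        simpa [Function.comp_def] using this
      have := hu.isTrace.green₂_smooth hc hb hf hχ
      simp only [hp] at this
      have e : ∀ z : ℝ × ℝ, u₂ z / ((deriv ψ z.2 : ℝ) : ℂ) * (deriv ψ z.2 * χ (z.1, ψ z.2)) =
          u₂ z * χ (z.1, ψ z.2) := fun z => by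
        have : ((deriv ψ z.2 : ℝ) : ℂ) ≠ 0 := by exact_mod_cast (hs.deriv_pos _).ne'
        field_simp
      simp only [e]
      rw [this]
      simp only [hT, hTb, hl.fix]
      congr 1
      rw [integral_congr_ae (g := fun _ => 0), integral_zero]
      · simp
      · filter_upwards [hsurf] with x hx
        simp [hx]
  refine ⟨htr.memH1 hc ((memLp_pull hs hf hu.memH1.memLp).restrict _)
    ((memLp_pull hs hf hu.memH1.memLp₁).restrict _) ((memLp_pull hs hf hu2).restrict _), htr, ?_, ?_⟩
  · simp only [hT]; simp
  · have := hu.quasiperiodic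
    rw [ae_restrict_iff' measurableSet_Ioo] at this ⊢
    filter_upwards [hs.quasiMeasurePreserving.ae this] with y hy hy'
    have h3 : φ y < b := by rw [hs.lt_iff, hl.fix]; exact hy'.2
    simp only [extendTrace, hper]
    by_cases h1 : f 0 < φ y
    · simp only [h1, if_true]; exact hy ⟨h1, h3⟩
    · simp [h1]

end Grating

/-! ### Representation of `u` as a vertical primitive. -/

namespace Grating

/-- Fubini on the half plane `y < s`. -/
lemma integral_mul_integral_Ioi {p q : ℝ → ℂ} (hp : Integrable p) (hq : Integrable q) :
    ∫ y, p y * ∫ s in Ioi y, q s = ∫ s, (∫ y in Iio s, p y) * q s := by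
  have hint : Integrable (fun z : ℝ × ℝ => {z : ℝ × ℝ | z.1 < z.2}.indicator
      (fun z => p z.1 * q z.2) z) (volume.prod volume) :=
    (hp.mul_prod hq).indicator (measurableSet_lt measurable_fst measurable_snd)
  have e1 : ∀ y, p y * ∫ s in Ioi y, q s =
      ∫ s, {z : ℝ × ℝ | z.1 < z.2}.indicator (fun z => p z.1 * q z.2) (y, s) := fun y => by
    rw [← integral_const_mul, ← integral_indicator measurableSet_Ioi]
    congr 1
  have e2 : ∀ s, (∫ y in Iio s, p y) * q s =
      ∫ y, {z : ℝ × ℝ | z.1 < z.2}.indicator (fun z => p z.1 * q z.2) (y, s) := fun s => by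
    rw [← integral_mul_const, ← integral_indicator measurableSet_Iio]
    congr 1
  simp only [e1, e2]
  exact integral_integral_swap hint

lemma hasDerivAt_neg_integral_Ioi {E : Type*} [NormedAddCommGroup E] [NormedSpace ℝ E]
    [CompleteSpace E] {g : ℝ → E} (hg : Continuous g) (hi : Integrable g) (y : ℝ) :
    HasDerivAt (fun y => -∫ s in Ioi y, g s) (g y) y := by
  have e : (fun y => -∫ s in Ioi y, g s) = fun z => (∫ s in y..z, g s) - ∫ s in Ioi y, g s := by
    funext z
    rw [← intervalIntegral.integral_Ioi_sub_Ioi' hi.integrableOn hi.integrableOn]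
    abel
  rw [e]
  exact (intervalIntegral.integral_hasDerivAt_right (hg.intervalIntegrable _ _)
    (hg.stronglyMeasurableAtFilter _ _) hg.continuousAt).sub_const _

section tail

variable {ψ : ℝ × ℝ → ℝ}

lemma hasCompactSupport_section (hc : HasCompactSupport ψ) (x : ℝ) :
    HasCompactSupport fun s => ψ (x, s) := by
  refine HasCompactSupport.intro (hc.isCompact.image continuous_snd) fun s hs => ?_
  exact image_eq_zero_of_notMem_tsupport fun h => hs ⟨_, h, rfl⟩

lemma integrable_section (h : Continuous ψ) (hc : HasCompactSupport ψ) (x : ℝ) :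
    Integrable fun s => ψ (x, s) :=
  Continuous.integrable_of_hasCompactSupport (h.comp (Continuous.prodMk_right x))
    (hasCompactSupport_section hc x)

/-- The tail is, up to sign, a convolution in the second variable with the indicator of the negative
half line, the first variable being a parameter; smoothness under the integral is then a property of
convolutions. -/
lemma contDiff_tail (h : ContDiff ℝ ∞ ψ) (hc : HasCompactSupport ψ) :
    ContDiff ℝ ∞ fun x : ℝ × ℝ => -∫ s in Ioi x.2, ψ (x.1, s) := by
  have key := contDiffOn_convolution_right_with_param (μ := (volume : Measure ℝ)) (n := ⊤)
    (f := (Iio (0 : ℝ)).indicator fun _ => (1 : ℝ)) (ContinuousLinearMap.lsmul ℝ ℝ)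
    (g := fun p s => ψ (p, s)) (s := univ) (k := Prod.snd '' tsupport ψ) isOpen_univ
    (hc.isCompact.image continuous_snd)
    (fun p x _ hx => image_eq_zero_of_notMem_tsupport fun h => hx ⟨_, h, rfl⟩)
    ((locallyIntegrable_const 1).indicator measurableSet_Iio) (h.contDiffOn)
  rw [univ_prod_univ, contDiffOn_univ] at key
  convert key.neg using 1
  funext x
  refine congrArg Neg.neg ?_
  rw [convolution, ← integral_indicator measurableSet_Ioi]
  have : ∀ t : ℝ, ((ContinuousLinearMap.lsmul ℝ ℝ)
      ((Iio (0 : ℝ)).indicator (fun _ => (1 : ℝ)) t)) (ψ (x.1, x.2 - t)) =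
      (Ioi x.2).indicator (fun s => ψ (x.1, s)) (x.2 - t) := fun t => by
    by_cases ht : t < 0
    · rw [indicator_of_mem (show t ∈ Iio (0 : ℝ) from ht),
        indicator_of_mem (show x.2 - t ∈ Ioi x.2 by simp only [mem_Ioi]; linarith)]
      simp
    · rw [indicator_of_notMem (show t ∉ Iio (0 : ℝ) from ht),
        indicator_of_notMem (show x.2 - t ∉ Ioi x.2 by simp only [mem_Ioi]; linarith)]
      simp
  simp only [this]
  exact (integral_sub_left_eq_self
    (fun s => (Ioi x.2).indicator (fun s => ψ (x.1, s)) s) volume x.2).symm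

lemma exists_tail_bound (h : Continuous ψ) (hc : HasCompactSupport ψ) :
    ∃ C, ∀ x : ℝ × ℝ, ‖-∫ s in Ioi x.2, ψ (x.1, s)‖ ≤ C := by
  obtain ⟨C, hC⟩ := hc.exists_bound_of_continuous h
  obtain ⟨R, hR⟩ := (hc.isCompact.image continuous_snd).isBounded.subset_closedBall 0
  have hz : ∀ x s : ℝ, s ∉ Metric.closedBall (0 : ℝ) R → ψ (x, s) = 0 := fun x s hs =>
    image_eq_zero_of_notMem_tsupport fun h => hs (hR ⟨_, h, rfl⟩)
  refine ⟨C * volume.real (Metric.closedBall (0 : ℝ) R), fun x => ?_⟩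
  rw [norm_neg]
  calc ‖∫ s in Ioi x.2, ψ (x.1, s)‖ ≤ ∫ s in Ioi x.2, ‖ψ (x.1, s)‖ :=
        norm_integral_le_integral_norm _
    _ ≤ ∫ s, ‖ψ (x.1, s)‖ := setIntegral_le_integral (integrable_section h hc _).norm
        (Filter.Eventually.of_forall fun _ => norm_nonneg _)
    _ = ∫ s in Metric.closedBall (0 : ℝ) R, ‖ψ (x.1, s)‖ :=
        (setIntegral_eq_integral_of_forall_compl_eq_zero fun s hs => by simp [hz _ _ hs]).symm
    _ ≤ C * volume.real (Metric.closedBall (0 : ℝ) R) := by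
        refine (le_abs_self _).trans ?_
        rw [← Real.norm_eq_abs]
        refine norm_setIntegral_le_of_norm_le_const (μ := volume) measure_closedBall_lt_top fun s _ => ?_
        simpa using hC _

end tail

variable {Λ b c α : ℝ} {f : ℝ → ℝ}

lemma stronglyMeasurable_integral_Iio {F : ℝ × ℝ → ℂ} (hF : StronglyMeasurable F) :
    StronglyMeasurable fun z : ℝ × ℝ => ∫ s in Iio z.2, F (z.1, s) := by
  have : ∀ z : ℝ × ℝ, ∫ s in Iio z.2, F (z.1, s) =
      ∫ s, {p : (ℝ × ℝ) × ℝ | p.2 < p.1.2}.indicator (fun p => F (p.1.1, p.2)) (z, s) :=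
    fun z => by
      rw [← integral_indicator measurableSet_Iio]
      congr 1
  simp only [this]
  refine StronglyMeasurable.integral_prod_right
    (f := fun z s => {p : (ℝ × ℝ) × ℝ | p.2 < p.1.2}.indicator (fun p => F (p.1.1, p.2)) (z, s)) ?_
  exact (hF.comp_measurable ((measurable_fst.comp measurable_fst).prodMk measurable_snd)).indicator
    (measurableSet_lt measurable_snd (measurable_snd.comp measurable_fst))

/-- On a bounded range of heights the primitive is dominated by the `L¹` norm of the vertical
section. Only local integrability is available, as the primitive need not decay upwards. -/
lemma locallyIntegrable_integral_Iio {F : ℝ × ℝ → ℂ} (hF : StronglyMeasurable F)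
    (hi : Integrable F) :
    LocallyIntegrable fun z : ℝ × ℝ => ∫ s in Iio z.2, F (z.1, s) := by
  rw [locallyIntegrable_iff]
  intro K hK
  obtain ⟨R, hR⟩ := (hK.image continuous_snd).isBounded.subset_closedBall 0
  have hsub : K ⊆ univ ×ˢ Metric.closedBall (0 : ℝ) R :=
    fun z hz => ⟨mem_univ _, hR ⟨z, hz, rfl⟩⟩
  refine IntegrableOn.mono_set ?_ hsub
  have h1 : Integrable (fun z : ℝ × ℝ => (∫ s, ‖F (z.1, s)‖) *
      (Metric.closedBall (0 : ℝ) R).indicator (fun _ => (1 : ℝ)) z.2) :=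
    Integrable.mul_prod (f := fun x => ∫ s, ‖F (x, s)‖) hi.norm.integral_prod_left
      ((integrable_indicator_iff measurableSet_closedBall).2
        (integrableOn_const measure_closedBall_lt_top.ne))
  have h2 : ∀ᵐ z : ℝ × ℝ, Integrable (fun s => F (z.1, s)) :=
    Measure.quasiMeasurePreserving_fst.ae hi.prod_right_ae
  refine (h1.integrableOn (s := univ ×ˢ Metric.closedBall (0 : ℝ) R)).mono'
    (stronglyMeasurable_integral_Iio hF).aestronglyMeasurable ?_
  filter_upwards [ae_restrict_of_ae h2,
    ae_restrict_mem (MeasurableSet.univ.prod measurableSet_closedBall)] with z hz hz'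
  rw [indicator_of_mem hz'.2, mul_one]
  exact (norm_integral_le_integral_norm _).trans (setIntegral_le_integral hz.norm
    (Filter.Eventually.of_forall fun _ => norm_nonneg _))

/-- A function of `H¹` vanishing on the surface is the integral of its vertical derivative. -/
theorem ae_eq_integral_of_zero_on_surface (hf : Continuous f) (hc : ∀ x, c ≤ f x)
    (hb : ∀ x, f x < b) {u u₁ u₂ t : ℝ × ℝ → ℂ} (hu : MemH1Sqp Λ f b α u u₁ u₂ t)
    {F : ℝ × ℝ → ℂ} (hF : StronglyMeasurable F) (hFu : F =ᵐ[volume] (cell Λ f b).indicator u₂) :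
    ∀ᵐ z : ℝ × ℝ, z.2 < b → (cell Λ f b).indicator u z = ∫ s in Iio z.2, F (z.1, s) := by
  have hm := measurableSet_cell (Λ := Λ) (b := b) hf
  have : IsFiniteMeasure (volume.restrict (cell Λ f b)) := ⟨by simpa using volume_cell_lt_top hc⟩
  have hui : Integrable ((cell Λ f b).indicator u) :=
    (integrable_indicator_iff hm).2 (hu.memH1.memLp.integrable (by norm_num))
  have hFi : Integrable F :=
    ((integrable_indicator_iff hm).2 (hu.memH1.memLp₂.integrable (by norm_num))).congr hFu.symm
  have hW := locallyIntegrable_integral_Iio hF hFi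
  have hU : IsOpen {z : ℝ × ℝ | z.2 < b} := isOpen_lt continuous_snd continuous_const
  have key := hU.ae_eq_zero_of_integral_contDiff_smul_eq_zero (μ := volume)
    (f := fun z => (cell Λ f b).indicator u z - ∫ s in Iio z.2, F (z.1, s))
    ((hui.locallyIntegrable.sub hW).locallyIntegrableOn _) ?_
  · filter_upwards [key] with z hz hz'
    exact sub_eq_zero.1 (hz hz')
  intro ψ h1 h2 h3
  have hz : ∀ x s, b ≤ s → ψ (x, s) = 0 := fun x s hs =>
    image_eq_zero_of_notMem_tsupport fun h => absurd (h3 h) (not_lt.2 hs)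
  -- This primitive of the test function vanishes on the top because `ψ` lives below `b`, while the
  -- trace vanishes on the surface; Green's formula then has no boundary term. It does not have
  -- compact support downwards, hence `green₂_smooth`.
  set φ : ℝ × ℝ → ℝ := fun x => -∫ s in Ioi x.2, ψ (x.1, s) with hφ
  have hφs : ContDiff ℝ ∞ fun x => (φ x : ℂ) :=
    Complex.ofRealCLM.contDiff.comp (contDiff_tail h1 h2)
  have hp : ∀ x, partial₂ (fun x => (φ x : ℂ)) x = ψ x := fun x =>
    (hasDerivAt_partial₂ (hφs.differentiable (by simp) x)).unique
      (hasDerivAt_neg_integral_Ioi (h1.continuous.comp (Continuous.prodMk_right x.1))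
        (integrable_section h1.continuous h2 x.1) x.2).ofReal_comp
  have hφb : ∀ x, φ (x, b) = 0 := fun x => by
    simp only [hφ]
    rw [setIntegral_congr_fun (g := fun _ => 0) measurableSet_Ioi fun s hs => hz _ _ (le_of_lt hs)]
    simp
  have hg := hu.isTrace.green₂_smooth hc hb hf hφs
  simp only [hp, hφb] at hg
  have hs0 : ∫ x in Ioo 0 Λ, t (x, f x) * (φ (x, f x) : ℂ) = 0 := by
    rw [integral_congr_ae (g := fun _ => 0), integral_zero]
    filter_upwards [hu.zero_on_surface] with x hx
    simp [hx]
  rw [hs0] at hg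
  simp only [Complex.ofReal_zero, mul_zero, integral_zero, sub_zero] at hg
  obtain ⟨C, hC⟩ := exists_tail_bound h1.continuous h2
  have hFφ : Integrable (fun z => F z * (φ z : ℂ)) :=
    hFi.mul_bdd (c := C) hφs.continuous.aestronglyMeasurable
      (Filter.Eventually.of_forall fun z => by rw [Complex.norm_real]; exact hC z)
  have huψ : Integrable (fun z => (cell Λ f b).indicator u z * (ψ z : ℂ)) := by
    obtain ⟨C, hC⟩ := h2.exists_bound_of_continuous h1.continuous
    exact hui.mul_bdd (c := C) (Complex.continuous_ofReal.comp h1.continuous).aestronglyMeasurable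
      (Filter.Eventually.of_forall fun z => by simpa using hC z)
  have hWψ : Integrable (fun z : ℝ × ℝ => ψ z • ∫ s in Iio z.2, F (z.1, s)) :=
    hW.integrable_smul_left_of_hasCompactSupport h1.continuous h2
  have hg' : (∫ z, (cell Λ f b).indicator u z * (ψ z : ℂ)) + ∫ z, F z * (φ z : ℂ) = 0 := by
    rw [← integral_add huψ hFφ, ← hg, ← integral_indicator hm]
    refine integral_congr_ae ?_
    filter_upwards [hFu] with z hz
    rw [hz]
    by_cases h : z ∈ cell Λ f b <;> simp [h]
  have hfub : ∫ z, F z * (φ z : ℂ) = -∫ z : ℝ × ℝ, ψ z • ∫ s in Iio z.2, F (z.1, s) := by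
    rw [Measure.volume_eq_prod, integral_prod _ hFφ, integral_prod _ hWψ, ← integral_neg]
    refine integral_congr_ae ?_
    filter_upwards [hFi.prod_right_ae] with x hx
    have := integral_mul_integral_Ioi hx ((integrable_section h1.continuous h2 x).ofReal (𝕜 := ℂ))
    simp only [hφ, Complex.ofReal_neg, mul_neg, integral_neg, Complex.real_smul]
    congr 1
    rw [← integral_congr_ae (Filter.Eventually.of_forall fun y => ?_), this,
      integral_congr_ae (Filter.Eventually.of_forall fun y => ?_)]
    · simp [mul_comm]
    · exact congrArg _ integral_ofReal
  simp only [smul_sub]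
  rw [integral_sub (by simpa [mul_comm] using huψ) hWψ]
  rw [hfub] at hg'
  simpa [mul_comm, sub_eq_add_neg] using hg'

end Grating

/-! ### The displacement estimate and Poincaré's inequality. -/

namespace Grating

lemma lintegral_sq_le {α : Type*} [MeasurableSpace α] (μ : Measure α) {g : α → ℝ≥0∞}
    (hg : AEMeasurable g μ) : (∫⁻ x, g x ∂μ) ^ 2 ≤ μ univ * ∫⁻ x, g x ^ 2 ∂μ := by
  have h := ENNReal.lintegral_mul_le_Lp_mul_Lq μ Real.HolderConjugate.two_two
    (f := fun _ => 1) (g := g) aemeasurable_const hg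
  simp only [Pi.mul_apply, one_mul, ENNReal.one_rpow, lintegral_const] at h
  calc (∫⁻ x, g x ∂μ) ^ 2 ≤ (μ univ ^ (1 / 2 : ℝ) * (∫⁻ x, g x ^ (2 : ℝ) ∂μ) ^ (1 / 2 : ℝ)) ^ 2 := by
        gcongr
    _ = μ univ * ∫⁻ x, g x ^ 2 ∂μ := by
        rw [mul_pow, ← ENNReal.rpow_mul_natCast, ← ENNReal.rpow_mul_natCast]
        norm_num

lemma enorm_setIntegral_Ico_sq_le {g : ℝ → ℂ} (hg : AEStronglyMeasurable g) {x y δ : ℝ}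
    (h : y - δ ≤ x) :
    ‖∫ s in Ico x y, g s‖ₑ ^ 2 ≤ ENNReal.ofReal δ * ∫⁻ s in Ico (y - δ) y, ‖g s‖ₑ ^ 2 := by
  calc ‖∫ s in Ico x y, g s‖ₑ ^ 2 ≤ (∫⁻ s in Ico x y, ‖g s‖ₑ) ^ 2 := by
        gcongr; exact enorm_integral_le_lintegral_enorm _
    _ ≤ (∫⁻ s in Ico (y - δ) y, ‖g s‖ₑ) ^ 2 := by
        gcongr
    _ ≤ _ := by
        refine (lintegral_sq_le _ hg.enorm.restrict).trans ?_
        simp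

variable {Λ b c α : ℝ} {f : ℝ → ℝ}

/-- Tonelli: each height `s` belongs to the windows below the heights `y` in `(s, s + δ]`, a set of
length `δ`. -/
lemma lintegral_window {E : ℝ × ℝ → ℝ≥0∞} (hE : Measurable E) (δ : ℝ) :
    ∫⁻ z : ℝ × ℝ, ∫⁻ s in Ico (z.2 - δ) z.2, E (z.1, s) = ENNReal.ofReal δ * ∫⁻ z, E z := by
  have hm : Measurable fun p : ℝ × ℝ × ℝ =>
      {p : ℝ × ℝ × ℝ | p.2.1 - δ ≤ p.2.2 ∧ p.2.2 < p.2.1}.indicator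
        (fun p => E (p.1, p.2.2)) p := by
    refine Measurable.indicator (hE.comp (measurable_fst.prodMk
      (measurable_snd.comp measurable_snd))) (MeasurableSet.inter ?_ ?_)
    · exact measurableSet_le ((measurable_fst.comp measurable_snd).sub_const _)
        (measurable_snd.comp measurable_snd)
    · exact measurableSet_lt (measurable_snd.comp measurable_snd)
        (measurable_fst.comp measurable_snd)
  have e1 : ∀ x y : ℝ, ∫⁻ s in Ico (y - δ) y, E (x, s) =
      ∫⁻ s, {p : ℝ × ℝ × ℝ | p.2.1 - δ ≤ p.2.2 ∧ p.2.2 < p.2.1}.indicator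
        (fun p => E (p.1, p.2.2)) (x, y, s) := fun x y => by
    rw [← lintegral_indicator measurableSet_Ico]
    congr 1
  have e2 : ∀ x s : ℝ, ∫⁻ y, {p : ℝ × ℝ × ℝ | p.2.1 - δ ≤ p.2.2 ∧ p.2.2 < p.2.1}.indicator
      (fun p => E (p.1, p.2.2)) (x, y, s) = ENNReal.ofReal δ * E (x, s) := fun x s => by
    have : ∀ y, {p : ℝ × ℝ × ℝ | p.2.1 - δ ≤ p.2.2 ∧ p.2.2 < p.2.1}.indicator
        (fun p => E (p.1, p.2.2)) (x, y, s) = (Ioc s (s + δ)).indicator (fun _ => E (x, s)) y :=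
      fun y => by
        simp only [indicator, mem_ofPred_eq, mem_Ioc, sub_le_iff_le_add]
        congr 1
        rw [and_comm]
    simp only [this]
    rw [lintegral_indicator measurableSet_Ioc, lintegral_const]
    simp [mul_comm]
  have hm2 : Measurable fun z : ℝ × ℝ => ∫⁻ s in Ico (z.2 - δ) z.2, E (z.1, s) := by
    simp only [e1]
    exact Measurable.lintegral_prod_right' (f := fun q : (ℝ × ℝ) × ℝ =>
      {p : ℝ × ℝ × ℝ | p.2.1 - δ ≤ p.2.2 ∧ p.2.2 < p.2.1}.indicator
        (fun p => E (p.1, p.2.2)) (q.1.1, q.1.2, q.2))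
      (hm.comp (MeasurableEquiv.prodAssoc.measurable))
  rw [Measure.volume_eq_prod, lintegral_prod _ hm2.aemeasurable, lintegral_prod _ hE.aemeasurable,
    ← lintegral_const_mul _ hE.lintegral_prod_right']
  refine lintegral_congr fun x => ?_
  simp only [e1]
  rw [lintegral_lintegral_swap]
  · simp only [e2]
    exact lintegral_const_mul _ (hE.comp measurable_prodMk_left)
  · exact (hm.comp measurable_prodMk_left).aemeasurable

/-- The `L²` norm of the difference between a function of `H¹` vanishing on the surface, extended
by zero, and its composition with a downward displacement by at most `δ`. -/
theorem lintegral_displacement_le (hf : Continuous f) (hc : ∀ x, c ≤ f x) (hb : ∀ x, f x < b)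
    {u u₁ u₂ t : ℝ × ℝ → ℂ} (hu : MemH1Sqp Λ f b α u u₁ u₂ t) {φ : ℝ → ℝ}
    (hφ : Measure.QuasiMeasurePreserving (fun x : ℝ × ℝ => (x.1, φ x.2)) volume volume) {δ : ℝ}
    (hδ : ∀ y ∈ Ioo c b, y - δ ≤ φ y ∧ φ y ≤ y) :
    ∫⁻ z in cell Λ f b, ‖u z - (cell Λ f b).indicator u (z.1, φ z.2)‖ₑ ^ 2 ≤
      ENNReal.ofReal δ ^ 2 * ∫⁻ z in cell Λ f b, ‖u₂ z‖ₑ ^ 2 := by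
  have hm := measurableSet_cell (Λ := Λ) (b := b) hf
  have : IsFiniteMeasure (volume.restrict (cell Λ f b)) := ⟨by simpa using volume_cell_lt_top hc⟩
  have hsm : AEStronglyMeasurable ((cell Λ f b).indicator u₂) volume :=
    (aestronglyMeasurable_indicator_iff hm).2 hu.memH1.memLp₂.1
  obtain ⟨F, hF, hFu⟩ : ∃ F, StronglyMeasurable F ∧ F =ᵐ[volume] (cell Λ f b).indicator u₂ :=
    ⟨hsm.mk _, hsm.stronglyMeasurable_mk, hsm.ae_eq_mk.symm⟩
  have hFi : Integrable F :=
    ((integrable_indicator_iff hm).2 (hu.memH1.memLp₂.integrable (by norm_num))).congr hFu.symm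
  have hrep := ae_eq_integral_of_zero_on_surface hf hc hb hu hF hFu
  have h2 : ∀ᵐ z : ℝ × ℝ, Integrable (fun s => F (z.1, s)) :=
    Measure.quasiMeasurePreserving_fst.ae hFi.prod_right_ae
  have hE : ∫⁻ z in cell Λ f b, ‖u₂ z‖ₑ ^ 2 = ∫⁻ z, ‖F z‖ₑ ^ 2 := by
    rw [← lintegral_indicator hm]
    refine lintegral_congr_ae ?_
    filter_upwards [hFu] with z hz
    rw [hz]
    by_cases h : z ∈ cell Λ f b <;> simp [h]
  calc ∫⁻ z in cell Λ f b, ‖u z - (cell Λ f b).indicator u (z.1, φ z.2)‖ₑ ^ 2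
      ≤ ∫⁻ z in cell Λ f b,
          ENNReal.ofReal δ * ∫⁻ s in Ico (z.2 - δ) z.2, ‖F (z.1, s)‖ₑ ^ 2 := by
        refine lintegral_mono_ae ?_
        -- The representation is needed at `z` and at the displaced point; the latter holds almost
        -- everywhere because the displacement pulls null sets back to null sets.
        filter_upwards [ae_restrict_of_ae hrep, ae_restrict_of_ae (hφ.ae hrep),
          ae_restrict_of_ae h2, ae_restrict_mem hm] with z h1 h1' h2 hz
        have hy := hδ z.2 (cell_subset hc hz).2
        have e1 := h1 hz.2.2.2
        have e2 := h1' (hy.2.trans_lt hz.2.2.2)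
        rw [indicator_of_mem hz] at e1
        -- Both values are primitives of the same function from below, so their difference is the
        -- integral between the two heights, even if the lower point has left the cell.
        have e3 : u z - (cell Λ f b).indicator u (z.1, φ z.2) =
            ∫ s in Ico (φ z.2) z.2, F (z.1, s) := by
          have hun : Iio z.2 = Iio (φ z.2) ∪ Ico (φ z.2) z.2 := (Iio_union_Ico_eq_Iio hy.2).symm
          rw [e1, e2, hun, setIntegral_union _ measurableSet_Ico h2.integrableOn h2.integrableOn]
          · ring
          · exact Set.disjoint_left.2 fun s hs hs' => absurd hs (not_lt.2 hs'.1)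
        rw [e3]
        exact enorm_setIntegral_Ico_sq_le
          (hF.comp_measurable measurable_prodMk_left).aestronglyMeasurable hy.1
    _ ≤ ∫⁻ z : ℝ × ℝ, ENNReal.ofReal δ * ∫⁻ s in Ico (z.2 - δ) z.2, ‖F (z.1, s)‖ₑ ^ 2 :=
        setLIntegral_le_lintegral _ _
    _ = ENNReal.ofReal δ ^ 2 * ∫⁻ z in cell Λ f b, ‖u₂ z‖ₑ ^ 2 := by
        rw [lintegral_const_mul' _ _ (by simp), lintegral_window (E := fun z => ‖F z‖ₑ ^ 2)
          (hF.measurable.enorm.pow_const 2), hE, sq, mul_assoc]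

lemma integral_norm_sq_eq_toReal {X : Type*} [MeasurableSpace X] {μ : Measure X} {u : X → ℂ}
    (hu : AEStronglyMeasurable u μ) :
    ∫ x, ‖u x‖ ^ 2 ∂μ = (∫⁻ x, ‖u x‖ₑ ^ 2 ∂μ).toReal := by
  rw [integral_eq_lintegral_of_nonneg_ae (Filter.Eventually.of_forall fun x => by positivity)
    (show AEStronglyMeasurable (fun x => ‖u x‖ ^ 2) μ from hu.norm.pow 2)]
  congr 1
  refine lintegral_congr fun x => ?_
  rw [ENNReal.ofReal_pow (norm_nonneg _), ofReal_norm]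

lemma lintegral_enorm_sq_lt_top {X : Type*} [MeasurableSpace X] {μ : Measure X} {u : X → ℂ}
    (hu : MemLp u 2 μ) : ∫⁻ x, ‖u x‖ₑ ^ 2 ∂μ < ⊤ := by
  have := lintegral_rpow_enorm_lt_top_of_eLpNorm_lt_top (by norm_num) (by norm_num) hu.2
  simpa using this

theorem integral_displacement_le (hf : Continuous f) (hc : ∀ x, c ≤ f x) (hb : ∀ x, f x < b)
    {u u₁ u₂ t : ℝ × ℝ → ℂ} (hu : MemH1Sqp Λ f b α u u₁ u₂ t) {φ : ℝ → ℝ}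
    (hφ : Measure.QuasiMeasurePreserving (fun x : ℝ × ℝ => (x.1, φ x.2)) volume volume) {δ : ℝ}
    (hδ0 : 0 ≤ δ) (hδ : ∀ y ∈ Ioo c b, y - δ ≤ φ y ∧ φ y ≤ y) :
    ∫ z in cell Λ f b, ‖u z - (cell Λ f b).indicator u (z.1, φ z.2)‖ ^ 2 ≤
      δ ^ 2 * ∫ z in cell Λ f b, ‖u₂ z‖ ^ 2 := by
  have hm := measurableSet_cell (Λ := Λ) (b := b) hf
  have h1 : AEStronglyMeasurable (fun z : ℝ × ℝ => (cell Λ f b).indicator u (z.1, φ z.2)) volume :=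
    ((aestronglyMeasurable_indicator_iff hm).2 hu.memH1.memLp.1).comp_quasiMeasurePreserving hφ
  rw [integral_norm_sq_eq_toReal
      (u := fun z => u z - (cell Λ f b).indicator u (z.1, φ z.2))
      (hu.memH1.memLp.1.sub h1.restrict),
    integral_norm_sq_eq_toReal hu.memH1.memLp₂.1]
  have := ENNReal.toReal_mono ?_ (lintegral_displacement_le hf hc hb hu hφ hδ)
  · rwa [ENNReal.toReal_mul, ENNReal.toReal_pow, ENNReal.toReal_ofReal hδ0] at this
  · exact ENNReal.mul_ne_top (by simp) (lintegral_enorm_sq_lt_top hu.memH1.memLp₂).ne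

/-- Poincaré's inequality in the vertical direction. -/
theorem integral_norm_sq_le (hf : Continuous f) (hc : ∀ x, c ≤ f x) (hb : ∀ x, f x < b)
    {u u₁ u₂ t : ℝ × ℝ → ℂ} (hu : MemH1Sqp Λ f b α u u₁ u₂ t) :
    ∫ z in cell Λ f b, ‖u z‖ ^ 2 ≤ (b - c) ^ 2 * ∫ z in cell Λ f b, ‖u₂ z‖ ^ 2 := by
  have hcb : c < b := (hc 0).trans_lt (hb 0)
  have hφ : Measure.QuasiMeasurePreserving (fun x : ℝ × ℝ => (x.1, x.2 - (b - c))) volume volume :=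
    ((MeasurePreserving.id (volume : Measure ℝ)).prod
      (measurePreserving_sub_right volume (b - c))).quasiMeasurePreserving
  -- A descent by `b - c` leads out of the cell, where the extension is zero, so the displacement
  -- difference is `u` itself.
  have := integral_displacement_le hf hc hb hu hφ (sub_pos.2 hcb).le
    (fun y _ => ⟨le_rfl, by linarith⟩)
  refine le_trans (le_of_eq (setIntegral_congr_fun (measurableSet_cell hf) fun z hz => ?_)) this
  have : (z.1, z.2 - (b - c)) ∉ cell Λ f b := fun h => by
    have := h.2.2.1
    have := hc z.1
    have := hz.2.2.2
    simp only at *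
    linarith
  simp [this]

end Grating

/-! ### Rellich's inequality by variation of the test function. -/

namespace Grating

lemma exists_isStretch {ψ : ℝ → ℝ} (h : ContDiff ℝ ∞ ψ) {a C : ℝ} (ha : 0 < a)
    (hl : ∀ z, a ≤ deriv ψ z) (hC : ∀ z, deriv ψ z ≤ C) : ∃ φ, IsStretch ψ φ := by
  have hd : Differentiable ℝ ψ := h.differentiable (by simp)
  have hmono : StrictMono ψ := strictMono_of_deriv_pos fun z => ha.trans_le (hl z)
  have hgrow : ∀ x y, x ≤ y → a * (y - x) ≤ ψ y - ψ x := fun x y hxy =>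
    mul_sub_le_image_sub_of_le_deriv hd hl hxy
  have htop : Filter.Tendsto ψ Filter.atTop Filter.atTop := by
    refine Filter.tendsto_atTop_mono' _ ?_
      (Filter.tendsto_atTop_add_const_left _ (ψ 0) (Filter.tendsto_id.const_mul_atTop ha))
    filter_upwards [Filter.eventually_ge_atTop 0] with y hy
    have := hgrow 0 y hy
    simp only [id]
    linarith
  have hbot : Filter.Tendsto ψ Filter.atBot Filter.atBot := by
    refine Filter.tendsto_atBot_mono' _ ?_
      (Filter.tendsto_atBot_add_const_left _ (ψ 0) (Filter.tendsto_id.const_mul_atBot ha))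
    filter_upwards [Filter.eventually_le_atBot 0] with y hy
    have := hgrow y 0 hy
    simp only [id]
    linarith
  have hsurj : Function.Surjective ψ := h.continuous.surjective htop hbot
  have hr := Function.surjInv_eq hsurj
  refine ⟨Function.surjInv hsurj, h, fun z => hmono.injective (hr _), hr, ?_, ⟨a, ha, hl⟩, C, hC⟩
  refine Monotone.measurable fun x y hxy => ?_
  rw [← hmono.le_iff_le, hr, hr]
  exact hxy

/-- Polarization replaces the products of `u` and its lift by squared norms, to which the change of
variables applies, and a squared difference, which is either discarded or small. -/
lemma re_mul_conj_eq (z w : ℂ) :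
    (z * conj w).re = (‖z‖ ^ 2 + ‖w‖ ^ 2 - ‖z - w‖ ^ 2) / 2 := by
  simp only [Complex.sq_norm, Complex.normSq_apply, Complex.mul_re, Complex.conj_re,
    Complex.conj_im, Complex.sub_re, Complex.sub_im]
  ring

lemma MemLp.integrable_mul_conj {X : Type*} [MeasurableSpace X] {μ : Measure X} {u v : X → ℂ}
    (hu : MemLp u 2 μ) (hv : MemLp v 2 μ) : Integrable (fun x => u x * conj (v x)) μ := by
  have : MemLp (fun x => conj (v x)) 2 μ := hv.star
  exact hu.integrable_mul this

lemma MemLp.integrable_norm_sq {X : Type*} [MeasurableSpace X] {μ : Measure X} {u : X → ℂ}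
    (hu : MemLp u 2 μ) : Integrable (fun x => ‖u x‖ ^ 2) μ :=
  (memLp_two_iff_integrable_sq_norm hu.1).1 hu

lemma integral_sub_add {X : Type*} [MeasurableSpace X] {μ : Measure X} {p q r : X → ℝ}
    (hp : Integrable p μ) (hq : Integrable q μ) (hr : Integrable r μ) :
    (∫ x, p x ∂μ) - (∫ x, q x ∂μ) + ∫ x, r x ∂μ = ∫ x, (p x - q x + r x) ∂μ := by
  have hpq : Integrable (fun x => p x - q x) μ := hp.sub hq
  rw [integral_add hpq hr, integral_sub hp hq]

lemma re_integral_mul_conj {X : Type*} [MeasurableSpace X] {μ : Measure X} {u v : X → ℂ}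
    (hu : MemLp u 2 μ) (hv : MemLp v 2 μ) :
    (∫ x, u x * conj (v x) ∂μ).re =
      ((∫ x, ‖u x‖ ^ 2 ∂μ) + (∫ x, ‖v x‖ ^ 2 ∂μ) - ∫ x, ‖u x - v x‖ ^ 2 ∂μ) / 2 := by
  have h1 := MemLp.integrable_norm_sq hu
  have h2 := MemLp.integrable_norm_sq hv
  have h3 := MemLp.integrable_norm_sq (hu.sub hv)
  simp only [Pi.sub_apply] at h3
  rw [add_sub_right_comm, integral_sub_add h1 h3 h2, ← integral_div]
  have := integral_re (MemLp.integrable_mul_conj hu hv)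
  simp only [RCLike.re_to_complex] at this
  rw [← this]
  refine integral_congr_ae (Filter.Eventually.of_forall fun x => ?_)
  simp only [re_mul_conj_eq]
  ring

variable {Λ b c α k : ℝ} {f : ℝ → ℝ} {ψ φ : ℝ → ℝ}

lemma IsLift.setIntegral_norm_sq_pull (h : IsLift f b ψ φ) (hf : Continuous f) (u : ℝ × ℝ → ℂ) :
    ∫ x in cell Λ f b, ‖pull Λ f b φ u x‖ ^ 2 =
      ∫ z in cell Λ f b, deriv ψ z.2 * ‖u z‖ ^ 2 := by
  rw [setIntegral_eq_integral_of_forall_compl_eq_zero fun x hx => by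
    simp [pull_eq_zero h _ hx]]
  have := h.isStretch.integral_comp₂ (fun z => ‖(cell Λ f b).indicator u z‖ ^ 2)
  rw [← integral_indicator (measurableSet_cell hf)]
  refine this.trans (integral_congr_ae (Filter.Eventually.of_forall fun z => ?_))
  by_cases hz : z ∈ cell Λ f b
  · simp only [indicator_of_mem hz, smul_eq_mul]
  · simp [indicator_of_notMem hz]

/-- The product `(1 + x)(1 - x + 2x²)` is `1 + x²(1 + 2x)`. This expands the factor `1 / ψ'` to
first order with a quadratic remainder. -/
lemma inv_one_add_le {x : ℝ} (hx : -(1 / 2) ≤ x) : (1 + x)⁻¹ ≤ 1 - x + 2 * x ^ 2 := by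
  rw [inv_le_iff_one_le_mul₀ (by linarith)]
  nlinarith [mul_nonneg (sq_nonneg x) (by linarith : 0 ≤ 1 + 2 * x)]

/-- Rellich's inequality for vertical vector fields that vanish on the top of the cell. -/
theorem rellich (hf : Continuous f) (hc : ∀ x, c ≤ f x) (hb : ∀ x, f x < b) (hΛ : 0 < Λ)
    (hper : f Λ = f 0) {u u₁ u₂ t : ℝ × ℝ → ℂ} (hu : MemH1Sqp Λ f b α u u₁ u₂ t) {g : ℝ → ℂ}
    (hvar : ∀ v v₁ v₂ r : ℝ × ℝ → ℂ, MemH1Sqp Λ f b α v v₁ v₂ r →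
      ∃ s : ℂ, IsDtNPairing Λ k b α t r s ∧
        (∫ x in cell Λ f b, (u₁ x * conj (v₁ x) + u₂ x * conj (v₂ x)))
          - (k : ℂ) ^ 2 * (∫ x in cell Λ f b, u x * conj (v x)) - s
        = ∫ x in Ioo 0 Λ, g x * conj (r (x, b)))
    {m : ℝ → ℝ} (hm : ContDiff ℝ ∞ m) (hmb : m b = 0) (hm0 : ∀ y, c ≤ y → 0 ≤ m y) {B B' : ℝ}
    (hB : ∀ y, |deriv m y| ≤ B) (hB' : ∀ y ≤ b, m y ≤ B') :
    ∫ z in cell Λ f b, deriv m z.2 * (‖u₂ z‖ ^ 2 - ‖u₁ z‖ ^ 2 + k ^ 2 * ‖u z‖ ^ 2) ≤ 0 := by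
  have hB0 : 0 ≤ B := (abs_nonneg _).trans (hB 0)
  have hB'0 : 0 ≤ B' := hmb ▸ hB' b le_rfl
  set μ := volume.restrict (cell Λ f b) with hμ
  set N₁ := fun z => ‖u₁ z‖ ^ 2
  set N₂ := fun z => ‖u₂ z‖ ^ 2
  set N₀ := fun z => ‖u z‖ ^ 2
  have i1 : Integrable N₁ μ := MemLp.integrable_norm_sq hu.memH1.memLp₁
  have i2 : Integrable N₂ μ := MemLp.integrable_norm_sq hu.memH1.memLp₂
  have i0 : Integrable N₀ μ := MemLp.integrable_norm_sq hu.memH1.memLp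
  have hm' : ContDiff ℝ ∞ (deriv m) := (contDiff_infty_iff_deriv.1 hm).2
  have cm : AEStronglyMeasurable (fun z : ℝ × ℝ => deriv m z.2) μ :=
    (hm'.continuous.comp continuous_snd).aestronglyMeasurable
  have j : ∀ {N : ℝ × ℝ → ℝ}, Integrable N μ → Integrable (fun z => deriv m z.2 * N z) μ :=
    fun hN => hN.bdd_mul cm (Filter.Eventually.of_forall fun z => by simpa using hB z.2)
  set J := ∫ z, deriv m z.2 * (N₂ z - N₁ z + k ^ 2 * N₀ z) ∂μ with hJ
  set K := (2 * B ^ 2 + k ^ 2 * B' ^ 2) * ∫ z, N₂ z ∂μ with hK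
  -- `K` collects the second-order errors: `2B²` from expanding `1 / ψ'` and `k² B'²` from the
  -- displacement of `u`. Letting `h` tend to zero gives the claim.
  suffices H : ∀ h : ℝ, 0 < h → h * B ≤ 1 / 2 → J ≤ h * K by
    refine le_of_forall_pos_le_add fun ε hε => ?_
    have hN : 0 ≤ ∫ z, N₂ z ∂μ := integral_nonneg fun z => by positivity
    have hK0 : 0 ≤ K := by positivity
    set h := min (1 / (2 * (B + 1))) (ε / (K + 1))
    have h0 : 0 < h := by positivity
    refine (H h h0 ?_).trans ?_
    · calc h * B ≤ 1 / (2 * (B + 1)) * (B + 1) := by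
            gcongr
            · exact min_le_left _ _
            · linarith
        _ = 1 / 2 := by field_simp
    · calc h * K ≤ ε / (K + 1) * (K + 1) := by
            gcongr
            · exact min_le_right _ _
            · linarith
        _ = 0 + ε := by field_simp; ring
  intro h h0 hhB
  set ψ : ℝ → ℝ := fun z => z + h * m z with hψ
  have hψs : ContDiff ℝ ∞ ψ := contDiff_id.add (contDiff_const.mul hm)
  have hψ' : ∀ z, deriv ψ z = 1 + h * deriv m z := fun z =>
    ((hasDerivAt_id z).add ((hm.differentiable (by simp) z).hasDerivAt.const_mul h)).deriv
  have hsmall : ∀ z, |h * deriv m z| ≤ 1 / 2 := fun z => by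
    rw [abs_mul, abs_of_pos h0]
    exact (mul_le_mul_of_nonneg_left (hB z) h0.le).trans hhB
  obtain ⟨φ, hφ⟩ := exists_isStretch hψs (a := 1 / 2) (C := 3 / 2) (by norm_num)
    (fun z => by rw [hψ']; linarith [(abs_le.1 (hsmall z)).1])
    (fun z => by rw [hψ']; linarith [(abs_le.1 (hsmall z)).2])
  have hl : IsLift f b ψ φ := ⟨hφ, by simp [hψ, hmb], fun x z hz => by
    have := mul_nonneg h0.le (hm0 z ((hc x).trans hz.le))
    simp only [hψ]; linarith⟩
  have hp := hu.pull hf hc hb hΛ hper hl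
  obtain ⟨s, hs, e1⟩ := hvar _ _ _ _ hu
  obtain ⟨s', hs', e2⟩ := hvar _ _ _ _ hp
  have hTb : ∀ x, extendTrace f t (x, φ b) = t (x, b) := fun x => by
    simp [extendTrace, hl.φ_top, hb]
  -- The lift does not change the trace on the top, so the pairing and the datum cancel between the
  -- two tests.
  have hss : s' = s := by
    refine hs'.unique ?_
    have : ∀ n, coeffN Λ b α (fun x => extendTrace f t (x.1, φ x.2)) n = coeffN Λ b α t n :=
      fun n => by simp only [coeffN, hTb]
    simp only [this]
    exact hs
  simp only [hTb] at e2
  rw [← e1, hss] at e2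
  have m1 := hu.memH1.memLp₁
  have m2 := hu.memH1.memLp₂
  have m0 := hu.memH1.memLp
  have p1 := hp.memH1.memLp₁
  have p2 := hp.memH1.memLp₂
  have p0 := hp.memH1.memLp
  have hsp : ∀ w : ℝ × ℝ → ℂ, ∫ x, ‖Grating.pull Λ f b φ w x‖ ^ 2 ∂μ =
      ∫ z, deriv ψ z.2 * ‖w z‖ ^ 2 ∂μ := hl.setIntegral_norm_sq_pull hf
  rw [← hμ] at m1 m2 m0 p1 p2 p0
  rw [integral_add (MemLp.integrable_mul_conj m1 m1) (MemLp.integrable_mul_conj m2 m2),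
    integral_add (MemLp.integrable_mul_conj m1 p1) (MemLp.integrable_mul_conj m2 p2)] at e2
  have e3 := congrArg Complex.re e2
  simp only [Complex.sub_re, Complex.add_re, ← Complex.ofReal_pow, Complex.re_ofReal_mul,
    re_integral_mul_conj m1 m1, re_integral_mul_conj m2 m2, re_integral_mul_conj m0 m0,
    re_integral_mul_conj m1 p1, re_integral_mul_conj m2 p2, re_integral_mul_conj m0 p0,
    hsp, sub_self, norm_zero, ne_eq, OfNat.ofNat_ne_zero,
    not_false_eq_true, zero_pow, integral_zero, sub_zero] at e3
  -- The gradient differences carry the sign that permits dropping them; no smallness is required,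
  -- which is why `H¹` is enough.
  have q1 : 0 ≤ ∫ x, ‖u₁ x - Grating.pull Λ f b φ u₁ x‖ ^ 2 ∂μ :=
    integral_nonneg fun z => by positivity
  have q2 : 0 ≤ ∫ x, ‖u₂ x - Grating.pull Λ f b φ (fun z => u₂ z / deriv ψ z.2) x‖ ^ 2 ∂μ :=
    integral_nonneg fun z => by positivity
  have q0 : ∫ x, ‖u x - Grating.pull Λ f b φ u x‖ ^ 2 ∂μ ≤ (h * B') ^ 2 * ∫ z, N₂ z ∂μ := by
    refine integral_displacement_le hf hc hb hu
      ((hφ.measurePreserving₂.quasiMeasurePreserving).mono_right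
        (withDensity_absolutelyContinuous _ _)) (by positivity) fun y hy => ⟨?_, ?_⟩
    -- Applying `ψ` to both sides turns the bound on `φ y` into `y - h B' + h m(y - h B') ≤ y`.
    · rw [← hφ.strictMono.le_iff_le, hφ.right_inv]
      have := mul_le_mul_of_nonneg_left
        (hB' (y - h * B') (by linarith [hy.2, mul_nonneg h0.le hB'0])) h0.le
      simp only [hψ]; linarith
    · rw [← hφ.strictMono.le_iff_le, hφ.right_inv]
      have := mul_nonneg h0.le (hm0 y hy.1.le)
      simp only [hψ]; linarith
  have r1 : ∀ {N : ℝ × ℝ → ℝ}, Integrable N μ → ∫ z, deriv ψ z.2 * N z ∂μ =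
      (∫ z, N z ∂μ) + h * ∫ z, deriv m z.2 * N z ∂μ := fun {N} hN => by
    rw [← integral_const_mul, ← integral_add hN ((j hN).const_mul h)]
    refine integral_congr_ae (Filter.Eventually.of_forall fun z => ?_)
    simp only [hψ']; ring
  have r2 : ∫ z, deriv ψ z.2 * ‖u₂ z / deriv ψ z.2‖ ^ 2 ∂μ ≤
      (∫ z, N₂ z ∂μ) - h * (∫ z, deriv m z.2 * N₂ z ∂μ) + 2 * h ^ 2 * B ^ 2 * ∫ z, N₂ z ∂μ := by
    rw [← integral_const_mul, ← integral_const_mul,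
      integral_sub_add i2 ((j i2).const_mul h) (i2.const_mul _)]
    refine integral_mono_of_nonneg (Filter.Eventually.of_forall fun z => ?_)
      ((i2.sub ((j i2).const_mul h)).add (i2.const_mul _))
      (Filter.Eventually.of_forall fun z => ?_)
    · have := (hφ.deriv_pos z.2).le
      positivity
    · have hpos := hφ.deriv_pos z.2
      have e : deriv ψ z.2 * ‖u₂ z / deriv ψ z.2‖ ^ 2 = (deriv ψ z.2)⁻¹ * N₂ z := by
        rw [norm_div, Complex.norm_real, Real.norm_of_nonneg hpos.le]
        simp only [N₂]
        field_simp
      beta_reduce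
      rw [e, hψ']
      have hN : 0 ≤ N₂ z := by positivity
      have hx := inv_one_add_le (x := h * deriv m z.2) (by linarith [(abs_le.1 (hsmall z.2)).1])
      have hx2 : (h * deriv m z.2) ^ 2 ≤ h ^ 2 * B ^ 2 := by
        rw [mul_pow]
        exact mul_le_mul_of_nonneg_left (sq_le_sq' (abs_le.1 (hB z.2)).1 (abs_le.1 (hB z.2)).2)
          (sq_nonneg h)
      have := mul_le_mul_of_nonneg_right
        (hx.trans (show _ ≤ 1 - h * deriv m z.2 + 2 * (h ^ 2 * B ^ 2) by linarith)) hN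
      linarith
  have hJ' : J = (∫ z, deriv m z.2 * N₂ z ∂μ) - (∫ z, deriv m z.2 * N₁ z ∂μ) +
      k ^ 2 * ∫ z, deriv m z.2 * N₀ z ∂μ := by
    rw [hJ, ← integral_const_mul, integral_sub_add (j i2) (j i1) ((j i0).const_mul _)]
    refine integral_congr_ae (Filter.Eventually.of_forall fun z => ?_)
    ring
  rw [r1 i1, r1 i0] at e3
  have hfin : h * J ≤ h * (h * K) := by
    have := mul_le_mul_of_nonneg_left q0 (sq_nonneg k)
    rw [hJ', hK]
    simp only [N₁, N₂, N₀] at *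
    linarith
  exact le_of_mul_le_mul_left hfin h0

end Grating

/-! ### Weak first-order systems on an interval. -/

namespace Grating

lemma continuous_integral_Ioi {W : ℝ → ℂ} (hW : Integrable W) :
    Continuous fun y => ∫ s in Ioi y, W s := by
  have e : (fun y => ∫ s in Ioi y, W s) = fun y => (∫ s in Ioi 0, W s) - ∫ s in (0 : ℝ)..y, W s := by
    funext y
    rw [← intervalIntegral.integral_Ioi_sub_Ioi' hW.integrableOn hW.integrableOn]
    abel
  rw [e]
  exact continuous_const.sub (intervalIntegral.continuous_primitive
    (fun a b => hW.intervalIntegrable) 0)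

lemma setIntegral_Ioi_indicator {W : ℝ → ℂ} {M b y : ℝ} (hy : M ≤ y) :
    ∫ s in Ioi y, (Ioo M b).indicator W s = ∫ s in Ioo y b, W s := by
  rw [setIntegral_indicator measurableSet_Ioo]
  congr 2
  ext s
  simp only [mem_inter_iff, mem_Ioi, mem_Ioo]
  constructor
  · exact fun h => ⟨h.1, h.2.2⟩
  · exact fun h => ⟨h.1, hy.trans_lt h.1, h.2⟩

/-- A function on `(M, b)` with weak derivative `W` and boundary value `A` at `b`. -/
lemma ae_eq_sub_integral_of_weak {U W : ℝ → ℂ} {M b : ℝ} (A : ℂ)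
    (hU : IntegrableOn U (Ioo M b)) (hW : IntegrableOn W (Ioo M b))
    (h : ∀ χ : ℝ → ℝ, ContDiff ℝ ∞ χ → (∀ y ≤ M, χ y = 0) →
      ∫ y in Ioo M b, (U y * deriv χ y + W y * χ y) = A * χ b) :
    ∀ᵐ y, y ∈ Ioo M b → U y = A - ∫ s in Ioo y b, W s := by
  have hU1 : Integrable ((Ioo M b).indicator U) := (integrable_indicator_iff measurableSet_Ioo).2 hU
  have hW1 : Integrable ((Ioo M b).indicator W) := (integrable_indicator_iff measurableSet_Ioo).2 hW
  have hT := continuous_integral_Ioi hW1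
  have key := isOpen_Ioo.ae_eq_zero_of_integral_contDiff_smul_eq_zero (μ := volume) (U := Ioo M b)
    (f := fun y => (Ioo M b).indicator U y - (A - ∫ s in Ioi y, (Ioo M b).indicator W s))
    ((hU1.locallyIntegrable.sub (continuous_const.sub hT).locallyIntegrable).locallyIntegrableOn _)
    ?_
  · filter_upwards [key] with y hy hy'
    have := hy hy'
    rw [indicator_of_mem hy', setIntegral_Ioi_indicator hy'.1.le] at this
    exact sub_eq_zero.1 this
  intro η h1 h2 h3
  have hz : ∀ y, y ∉ Ioo M b → η y = 0 := fun y hy =>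
    image_eq_zero_of_notMem_tsupport fun h => hy (h3 h)
  have hηi : Integrable η := h1.continuous.integrable_of_hasCompactSupport h2
  -- The primitive of `η` from the left vanishes below `M` as required, but equals the total
  -- integral of `η` at `b`; this is how the boundary value `A` enters.
  set χ : ℝ → ℝ := fun y => ∫ s in Iio y, η s with hχ
  have hχ' : ∀ y, χ y = (-∫ s in Ioi y, η s) + ∫ s, η s := fun y => by
    have := intervalIntegral.integral_Iic_add_Ioi (b := y) hηi.integrableOn hηi.integrableOn
    simp only [hχ]
    rw [← this, integral_Iic_eq_integral_Iio]
    ring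
  have hder : ∀ y, HasDerivAt χ (η y) y := fun y => by
    have := (hasDerivAt_neg_integral_Ioi h1.continuous hηi y).add_const (∫ s, η s)
    rwa [show χ = _ from funext hχ']
  have hχs : ContDiff ℝ ∞ χ := contDiff_infty_iff_deriv.2 ⟨fun y => (hder y).differentiableAt, by
    rw [show deriv χ = η from funext fun y => (hder y).deriv]; exact h1⟩
  have hχM : ∀ y ≤ M, χ y = 0 := fun y hy => by
    simp only [hχ]
    rw [setIntegral_congr_fun (g := fun _ => 0) measurableSet_Iio
      fun s hs => hz s fun h => absurd h.1 (not_lt.2 (le_of_lt (lt_of_lt_of_le hs hy)))]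
    simp
  have hχb : χ b = ∫ s, η s := by
    rw [hχ', setIntegral_congr_fun (g := fun _ => 0) measurableSet_Ioi
      fun s hs => hz s fun h => absurd h.2 (not_lt.2 (le_of_lt hs))]
    simp
  have hh := h χ hχs hχM
  simp only [(hder _).deriv] at hh
  obtain ⟨C, hC⟩ := h2.exists_bound_of_continuous h1.continuous
  have hUη : Integrable fun y => (Ioo M b).indicator U y * (η y : ℂ) :=
    hU1.mul_bdd (c := C) (Complex.continuous_ofReal.comp h1.continuous).aestronglyMeasurable
      (Filter.Eventually.of_forall fun z => by rw [Complex.norm_real]; exact hC z)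
  have hWχ : Integrable fun y => (Ioo M b).indicator W y * (χ y : ℂ) := by
    refine hW1.mul_bdd (c := ∫ s, ‖η s‖)
      (Complex.continuous_ofReal.comp hχs.continuous).aestronglyMeasurable
      (Filter.Eventually.of_forall fun z => ?_)
    rw [Complex.norm_real]
    exact (norm_integral_le_integral_norm _).trans (setIntegral_le_integral hηi.norm
      (Filter.Eventually.of_forall fun _ => norm_nonneg _))
  have hηT : Integrable fun y => (η y : ℂ) * ∫ s in Ioi y, (Ioo M b).indicator W s := by
    refine Continuous.integrable_of_hasCompactSupport
      ((Complex.continuous_ofReal.comp h1.continuous).mul hT) ?_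
    exact HasCompactSupport.mul_right (h2.comp_left Complex.ofReal_zero)
  have hh2 : (∫ y, (Ioo M b).indicator U y * (η y : ℂ)) +
      ∫ y, (Ioo M b).indicator W y * (χ y : ℂ) = A * χ b := by
    rw [← integral_add hUη hWχ, ← hh, ← integral_indicator measurableSet_Ioo]
    refine integral_congr_ae (Filter.Eventually.of_forall fun y => ?_)
    by_cases hy : y ∈ Ioo M b
    · simp only [indicator_of_mem hy]
    · simp only [indicator_of_notMem hy]; simp
  have htri := integral_mul_integral_Ioi (hηi.ofReal (𝕜 := ℂ)) hW1
  have e : ∀ s, (∫ y in Iio s, ((η y : ℝ) : ℂ)) = χ s := fun s => integral_ofReal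
  simp only [RCLike.ofReal_eq_complex_ofReal, e] at htri
  have hηA : Integrable fun y => (η y : ℂ) * A := (hηi.ofReal (𝕜 := ℂ)).mul_const A
  have : ∀ y, η y • ((Ioo M b).indicator U y - (A - ∫ s in Ioi y, (Ioo M b).indicator W s)) =
      (Ioo M b).indicator U y * (η y : ℂ) - (η y : ℂ) * A +
        (η y : ℂ) * ∫ s in Ioi y, (Ioo M b).indicator W s := fun y => by
    rw [Complex.real_smul]; ring
  simp only [this]
  have hsub : Integrable fun y => (Ioo M b).indicator U y * (η y : ℂ) - (η y : ℂ) * A :=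
    hUη.sub hηA
  rw [integral_add hsub hηT, integral_sub hUη hηA, htri, integral_mul_const]
  have e2 : ∫ y, ((η y : ℝ) : ℂ) = χ b := by rw [hχb]; exact integral_ofReal
  rw [e2]
  have e3 : ∫ y, (χ y : ℂ) * (Ioo M b).indicator W y = ∫ y, (Ioo M b).indicator W y * (χ y : ℂ) := by
    simp only [mul_comm]
  rw [e3]
  linear_combination hh2

/-- Conservation of `‖W‖² + κ ‖U‖²` for the system `U' = W`, `W' = -κ U`. -/
lemma ae_energy_eq {U W : ℝ → ℂ} {M b κ : ℝ} {A B : ℂ}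
    (hU : ∀ᵐ y, y ∈ Ioo M b → U y = A - ∫ s in Ioo y b, W s)
    (hWi : IntegrableOn W (Ioo M b))
    (hW : ∀ᵐ y, y ∈ Ioo M b → W y = B - ∫ s in Ioo y b, -(κ : ℂ) * U s) :
    ∀ᵐ y, y ∈ Ioo M b → ‖W y‖ ^ 2 + κ * ‖U y‖ ^ 2 = ‖B‖ ^ 2 + κ * ‖A‖ ^ 2 := by
  have hW1 : Integrable ((Ioo M b).indicator W) :=
    (integrable_indicator_iff measurableSet_Ioo).2 hWi
  -- Bootstrap: `P` is a continuous version of `U`, `Q` is a differentiable version of `W` built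
  -- from `P`, and `R` is a differentiable version of `U` built from `Q`. On the closed interval `R`
  -- and `P` coincide.
  set P : ℝ → ℂ := fun y => A - ∫ s in Ioi y, (Ioo M b).indicator W s with hP
  have hPc : Continuous P := continuous_const.sub (continuous_integral_Ioi hW1)
  have hPy : ∀ y, M ≤ y → P y = A - ∫ s in Ioo y b, W s := fun y hy => by
    simp only [hP, setIntegral_Ioi_indicator hy]
  set Q : ℝ → ℂ := fun y => B + κ * ∫ s in y..b, P s with hQ
  have hQd : ∀ y, HasDerivAt Q (-(κ * P y)) y := fun y => by
    have := ((intervalIntegral.integral_hasDerivAt_left (hPc.intervalIntegrable y b)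
      (hPc.stronglyMeasurableAtFilter _ _) hPc.continuousAt).const_mul (κ : ℂ)).const_add B
    simpa only [mul_neg] using this
  have hQc : Continuous Q := continuous_iff_continuousAt.2 fun y => (hQd y).continuousAt
  have hUP : ∀ᵐ y, y ∈ Ioo M b → U y = P y := by
    filter_upwards [hU] with y hy hy'
    rw [hy hy', hPy y hy'.1.le]
  have hWQ : ∀ᵐ y, y ∈ Ioo M b → W y = Q y := by
    filter_upwards [hW] with y hy hy'
    rw [hy hy', hQ]
    simp only
    rw [intervalIntegral.integral_of_le hy'.2.le, integral_Ioc_eq_integral_Ioo, integral_const_mul,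
      neg_mul, sub_neg_eq_add]
    congr 2
    refine setIntegral_congr_ae measurableSet_Ioo ?_
    filter_upwards [hUP] with s hs hs'
    exact hs ⟨hy'.1.trans hs'.1, hs'.2⟩
  set R : ℝ → ℂ := fun y => A - ∫ s in y..b, Q s with hR
  have hRd : ∀ y, HasDerivAt R (Q y) y := fun y => by
    have := (intervalIntegral.integral_hasDerivAt_left (hQc.intervalIntegrable y b)
      (hQc.stronglyMeasurableAtFilter _ _) hQc.continuousAt).const_sub A
    simpa using this
  have hRP : ∀ y ∈ Icc M b, R y = P y := fun y hy => by
    rw [hPy y hy.1, hR]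
    simp only
    rw [intervalIntegral.integral_of_le hy.2, integral_Ioc_eq_integral_Ioo]
    congr 1
    refine setIntegral_congr_ae measurableSet_Ioo ?_
    filter_upwards [hWQ] with s hs hs'
    exact (hs ⟨hy.1.trans_lt hs'.1, hs'.2⟩).symm
  have hEd : ∀ y ∈ Icc M b, HasDerivAt (fun y => ‖Q y‖ ^ 2 + κ * ‖R y‖ ^ 2) 0 y := fun y hy => by
    have := (hQd y).norm_sq.add ((hRd y).norm_sq.const_mul κ)
    refine HasDerivAt.congr_deriv this ?_
    rw [← hRP y hy]
    -- With `Q' = -κ R` and `R' = Q` the two real inner products cancel.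
    simp only [Complex.inner, Complex.mul_re, Complex.neg_re, Complex.neg_im, Complex.mul_im,
      Complex.ofReal_re, Complex.ofReal_im, Complex.conj_re, Complex.conj_im]
    ring
  filter_upwards [hUP, hWQ] with y h1 h2 hy
  have hconst := constant_of_has_deriv_right_zero
    (f := fun y => ‖Q y‖ ^ 2 + κ * ‖R y‖ ^ 2) (a := y) (b := b)
    (fun z hz => (hEd z ⟨hy.1.le.trans hz.1, hz.2⟩).continuousAt.continuousWithinAt)
    (fun z hz => (hEd z ⟨hy.1.le.trans hz.1, hz.2.le⟩).hasDerivWithinAt) b ⟨hy.2.le, le_rfl⟩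
  rw [h1 hy, h2 hy, ← hRP y ⟨hy.1.le, hy.2.le⟩]
  rw [← hconst]
  simp [hQ, hR]

end Grating

/-! ### Test functions supported above the surface. -/

namespace Grating

variable {Λ b c α k M : ℝ} {f : ℝ → ℝ}

lemma memLp_restrict_of_continuous {X E : Type*} [TopologicalSpace X] [MeasurableSpace X]
    [OpensMeasurableSpace X] [SecondCountableTopology X] [NormedAddCommGroup E]
    [SecondCountableTopologyEither X E] {μ : Measure X}
    {w : X → E} (hw : Continuous w) {K s : Set X} (hK : IsCompact K) (hs : s ⊆ K)
    (hsm : MeasurableSet s) (hμ : μ s < ⊤) (p : ℝ≥0∞) : MemLp w p (μ.restrict s) := by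
  obtain ⟨C, hC⟩ := hK.exists_bound_of_continuousOn hw.continuousOn
  have : IsFiniteMeasure (μ.restrict s) := ⟨by simpa using hμ⟩
  refine MemLp.of_bound hw.aestronglyMeasurable C ?_
  filter_upwards [ae_restrict_mem hsm] with x hx using hC x (hs hx)

lemma memLp_Ioo_of_continuous {w : ℝ → ℂ} (hw : Continuous w) (x y : ℝ) (p : ℝ≥0∞) :
    MemLp w p (volume.restrict (Ioo x y)) :=
  memLp_restrict_of_continuous hw isCompact_Icc Ioo_subset_Icc_self measurableSet_Ioo (by simp) p

lemma memLp_cell_of_continuous {w : ℝ × ℝ → ℂ} (hw : Continuous w) (hf : Continuous f)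
    (hc : ∀ x, c ≤ f x) (p : ℝ≥0∞) : MemLp w p (volume.restrict (cell Λ f b)) :=
  memLp_restrict_of_continuous hw (isCompact_Icc.prod isCompact_Icc)
    ((cell_subset hc).trans (prod_mono Ioo_subset_Icc_self Ioo_subset_Icc_self))
    (measurableSet_cell hf) (volume_cell_lt_top hc) p

lemma strip_subset_cell (hM : ∀ x, f x < M) : Ioo 0 Λ ×ˢ Ioo M b ⊆ cell Λ f b :=
  fun _ hz => ⟨hz.1.1, hz.1.2, (hM _).trans hz.2.1, hz.2.2⟩

lemma setIntegral_cell_eq_strip (hf : Continuous f) (hM : ∀ x, f x < M)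
    {E : Type*} [NormedAddCommGroup E] [NormedSpace ℝ E] {w : ℝ × ℝ → E}
    (hw : ∀ z : ℝ × ℝ, z.2 ≤ M → w z = 0) :
    ∫ z in cell Λ f b, w z = ∫ z in Ioo 0 Λ ×ˢ Ioo M b, w z := by
  refine setIntegral_eq_of_subset_of_forall_sdiff_eq_zero (measurableSet_cell hf)
    (strip_subset_cell hM) fun z hz => hw z ?_
  by_contra h
  exact hz.2 ⟨⟨hz.1.1, hz.1.2.1⟩, not_le.1 h, hz.1.2.2.2⟩

lemma setIntegral_strip {E : Type*} [NormedAddCommGroup E] [NormedSpace ℝ E]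
    (w : ℝ × ℝ → E) (hw : IntegrableOn w (Ioo 0 Λ ×ˢ Ioo M b)) :
    ∫ z in Ioo 0 Λ ×ˢ Ioo M b, w z = ∫ x in Ioo 0 Λ, ∫ y in Ioo M b, w (x, y) :=
  setIntegral_prod w hw

lemma setIntegral_strip_symm {E : Type*} [NormedAddCommGroup E] [NormedSpace ℝ E]
    (w : ℝ × ℝ → E) (hw : IntegrableOn w (Ioo 0 Λ ×ˢ Ioo M b)) :
    ∫ z in Ioo 0 Λ ×ˢ Ioo M b, w z = ∫ y in Ioo M b, ∫ x in Ioo 0 Λ, w (x, y) := by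
  rw [setIntegral_strip w hw]
  refine integral_integral_swap (f := fun x y => w (x, y)) ?_
  rwa [IntegrableOn, Measure.volume_eq_prod, ← Measure.prod_restrict] at hw

lemma setIntegral_Ioo_deriv {E : Type*} [NormedAddCommGroup E] [NormedSpace ℝ E]
    [CompleteSpace E] {F F' : ℝ → E} {x y : ℝ} (hxy : x ≤ y)
    (h : ∀ s, HasDerivAt F (F' s) s) (hF' : Continuous F') :
    ∫ s in Ioo x y, F' s = F y - F x := by
  rw [← integral_Ioc_eq_integral_Ioo, ← intervalIntegral.integral_of_le hxy]
  exact intervalIntegral.integral_eq_sub_of_hasDerivAt (fun s _ => h s)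
    (hF'.intervalIntegrable _ _)

lemma partial₁_eq_zero {w : ℝ × ℝ → ℂ} (h : ContDiff ℝ ∞ w)
    (h0 : ∀ z : ℝ × ℝ, z.2 ≤ M → w z = 0) {z : ℝ × ℝ} (hz : z.2 ≤ M) : partial₁ w z = 0 := by
  have := hasDerivAt_partial₁ (h.differentiable (by simp) z)
  rw [show (fun s => w (s, z.2)) = fun _ => 0 from funext fun s => h0 (s, z.2) hz] at this
  exact this.unique (hasDerivAt_const _ _)

/-- At height `M` itself the function is known to vanish only from below, and the one-sided
derivative determines the derivative. -/
lemma partial₂_eq_zero {w : ℝ × ℝ → ℂ} (h : ContDiff ℝ ∞ w)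
    (h0 : ∀ z : ℝ × ℝ, z.2 ≤ M → w z = 0) {z : ℝ × ℝ} (hz : z.2 ≤ M) : partial₂ w z = 0 := by
  have h1 := (hasDerivAt_partial₂ (h.differentiable (by simp) z)).hasDerivWithinAt (s := Iic z.2)
  have h2 : HasDerivWithinAt (fun s => w (z.1, s)) 0 (Iic z.2) z.2 :=
    (hasDerivWithinAt_const z.2 (Iic z.2) (0 : ℂ)).congr
      (fun s hs => h0 (z.1, s) (le_trans hs hz)) (h0 z hz)
  exact (uniqueDiffWithinAt_Iic z.2).eq_deriv _ h1 h2

/-- The support condition reduces the cell to a rectangle, where Fubini and the fundamental theorem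
of calculus apply and the Lipschitz boundary plays no role. -/
lemma setIntegral_cell_partial₁ (hf : Continuous f) (hc : ∀ x, c ≤ f x) (hM : ∀ x, f x < M)
    (hΛ : 0 < Λ) {w : ℝ × ℝ → ℂ} (h : ContDiff ℝ ∞ w) (h0 : ∀ z : ℝ × ℝ, z.2 ≤ M → w z = 0) :
    ∫ z in cell Λ f b, partial₁ w z =
      (∫ y in Ioo (f Λ) b, w (Λ, y)) - ∫ y in Ioo (f 0) b, w (0, y) := by
  have hp := continuous_partial₁ h
  have hi : IntegrableOn (partial₁ w) (Ioo 0 Λ ×ˢ Ioo M b) :=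
    (memLp_one_iff_integrable.1 (memLp_cell_of_continuous hp hf hc 1)).mono_measure
      (Measure.restrict_mono (strip_subset_cell hM) le_rfl)
  rw [setIntegral_cell_eq_strip hf hM fun z hz => partial₁_eq_zero h h0 hz,
    setIntegral_strip_symm _ hi]
  have e1 : ∀ y, ∫ x in Ioo 0 Λ, partial₁ w (x, y) = w (Λ, y) - w (0, y) := fun y =>
    setIntegral_Ioo_deriv (F := fun x => w (x, y)) hΛ.le
      (fun s => hasDerivAt_partial₁ (h.differentiable (by simp) (s, y)))
      (hp.comp (Continuous.prodMk_left y))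
  have e2 : ∀ x, ∫ y in Ioo (f x) b, w (x, y) = ∫ y in Ioo M b, w (x, y) := fun x =>
    setIntegral_eq_of_subset_of_forall_sdiff_eq_zero measurableSet_Ioo
      (Ioo_subset_Ioo_left (hM x).le) fun y hy => h0 (x, y) (by
        by_contra h'
        exact hy.2 ⟨not_le.1 h', hy.1.2⟩)
  have hwi : ∀ x, Integrable (fun y => w (x, y)) (volume.restrict (Ioo M b)) := fun x =>
    memLp_one_iff_integrable.1
      (memLp_Ioo_of_continuous (h.continuous.comp (Continuous.prodMk_right x)) _ _ _)
  simp only [e1, e2]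
  exact integral_sub (hwi Λ) (hwi 0)

lemma setIntegral_cell_partial₂ (hf : Continuous f) (hc : ∀ x, c ≤ f x) (hM : ∀ x, f x < M)
    (hMb : M < b) {w : ℝ × ℝ → ℂ} (h : ContDiff ℝ ∞ w)
    (h0 : ∀ z : ℝ × ℝ, z.2 ≤ M → w z = 0) :
    ∫ z in cell Λ f b, partial₂ w z = ∫ x in Ioo 0 Λ, w (x, b) := by
  have hp := continuous_partial₂ h
  have hi : IntegrableOn (partial₂ w) (Ioo 0 Λ ×ˢ Ioo M b) :=
    (memLp_one_iff_integrable.1 (memLp_cell_of_continuous hp hf hc 1)).mono_measure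
      (Measure.restrict_mono (strip_subset_cell hM) le_rfl)
  rw [setIntegral_cell_eq_strip hf hM fun z hz => partial₂_eq_zero h h0 hz,
    setIntegral_strip _ hi]
  have e1 : ∀ x, ∫ y in Ioo M b, partial₂ w (x, y) = w (x, b) - w (x, M) := fun x =>
    setIntegral_Ioo_deriv (F := fun y => w (x, y)) hMb.le
      (fun s => hasDerivAt_partial₂ (h.differentiable (by simp) (x, s)))
      (hp.comp (Continuous.prodMk_right x))
  simp only [e1]
  simp only [h0 (_, M) le_rfl, sub_zero]

lemma partial₁_mul {v w : ℝ × ℝ → ℂ} (hv : ContDiff ℝ ∞ v) (hw : ContDiff ℝ ∞ w) (z : ℝ × ℝ) :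
    partial₁ (fun z => v z * w z) z = v z * partial₁ w z + partial₁ v z * w z := by
  have := (hasDerivAt_partial₁ (hv.differentiable (by simp) z)).mul
    (hasDerivAt_partial₁ (hw.differentiable (by simp) z))
  rw [(hasDerivAt_partial₁ ((hv.mul hw).differentiable (by simp) z)).unique this]
  ring

lemma partial₂_mul {v w : ℝ × ℝ → ℂ} (hv : ContDiff ℝ ∞ v) (hw : ContDiff ℝ ∞ w) (z : ℝ × ℝ) :
    partial₂ (fun z => v z * w z) z = v z * partial₂ w z + partial₂ v z * w z := by
  have := (hasDerivAt_partial₂ (hv.differentiable (by simp) z)).mul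
    (hasDerivAt_partial₂ (hw.differentiable (by simp) z))
  rw [(hasDerivAt_partial₂ ((hv.mul hw).differentiable (by simp) z)).unique this]
  ring

/-- A smooth quasi-periodic function that vanishes below a line above the surface is in
`H¹_{S,qp}`. -/
theorem memH1Sqp_of_contDiff (hf : Continuous f) (hc : ∀ x, c ≤ f x) (hM : ∀ x, f x < M)
    (hMb : M < b) (hΛ : 0 < Λ) {v : ℝ × ℝ → ℂ} (hv : ContDiff ℝ ∞ v)
    (h0 : ∀ z : ℝ × ℝ, z.2 ≤ M → v z = 0)
    (hq : ∀ y, v (0, y) = v (Λ, y) * Complex.exp (-(Complex.I * α * Λ))) :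
    MemH1Sqp Λ f b α v (partial₁ v) (partial₂ v) v := by
  have hS : ∀ x, v (x, f x) = 0 := fun x => h0 _ (hM x).le
  have htr : IsTrace Λ f b v (partial₁ v) (partial₂ v) v := by
    refine ⟨?_, ?_, ?_, ?_, ?_, ?_⟩
    · simp only [hS]; exact MemLp.zero
    · exact memLp_Ioo_of_continuous (hv.continuous.comp (Continuous.prodMk_left b)) _ _ _
    · exact memLp_Ioo_of_continuous (hv.continuous.comp (Continuous.prodMk_right 0)) _ _ _
    · exact memLp_Ioo_of_continuous (hv.continuous.comp (Continuous.prodMk_right Λ)) _ _ _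
    · intro φ h1 _
      simp only [hS, zero_mul, integral_zero, zero_add, ← partial₁_mul hv h1]
      exact setIntegral_cell_partial₁ hf hc hM hΛ (hv.mul h1) fun z hz => by simp [h0 z hz]
    · intro φ h1 _
      simp only [hS, zero_mul, integral_zero, sub_zero, ← partial₂_mul hv h1]
      exact setIntegral_cell_partial₂ hf hc hM hMb (hv.mul h1) fun z hz => by simp [h0 z hz]
  refine ⟨htr.memH1 hc (memLp_cell_of_continuous hv.continuous hf hc 2)
    (memLp_cell_of_continuous (continuous_partial₁ hv) hf hc 2)
    (memLp_cell_of_continuous (continuous_partial₂ hv) hf hc 2), htr, ?_, ?_⟩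
  · simp [hS]
  · exact Filter.Eventually.of_forall hq

end Grating

/-! ### Fourier modes in the flat strip. -/

namespace Grating

variable {Λ b c α k M : ℝ} {f : ℝ → ℝ}

/-- The function `χ(x₂) exp(σ x₁)`. -/
noncomputable def wave (σ : ℂ) (χ : ℝ → ℝ) (z : ℝ × ℝ) : ℂ := (χ z.2 : ℂ) * Complex.exp (σ * z.1)

lemma contDiff_wave {σ : ℂ} {χ : ℝ → ℝ} (hχ : ContDiff ℝ ∞ χ) : ContDiff ℝ ∞ (wave σ χ) :=
  (Complex.ofRealCLM.contDiff.comp (hχ.comp contDiff_snd)).mul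
    (contDiff_const.mul (Complex.ofRealCLM.contDiff.comp contDiff_fst)).cexp

lemma continuous_wave {σ : ℂ} {χ : ℝ → ℝ} (hχ : Continuous χ) : Continuous (wave σ χ) := by
  unfold wave
  fun_prop

lemma partial₁_wave {σ : ℂ} {χ : ℝ → ℝ} (hχ : ContDiff ℝ ∞ χ) (z : ℝ × ℝ) :
    partial₁ (wave σ χ) z = σ * wave σ χ z := by
  refine (hasDerivAt_partial₁ ((contDiff_wave hχ).differentiable (by simp) z)).unique ?_
  have := (((hasDerivAt_id z.1).ofReal_comp.const_mul σ).cexp).const_mul (χ z.2 : ℂ)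
  refine HasDerivAt.congr_deriv this ?_
  simp only [wave, id, Complex.ofReal_one]
  ring

lemma partial₂_wave {σ : ℂ} {χ : ℝ → ℝ} (hχ : ContDiff ℝ ∞ χ) (z : ℝ × ℝ) :
    partial₂ (wave σ χ) z = wave σ (deriv χ) z := by
  refine (hasDerivAt_partial₂ ((contDiff_wave hχ).differentiable (by simp) z)).unique ?_
  exact ((hχ.differentiable (by simp) z.2).hasDerivAt.ofReal_comp).mul_const
    (Complex.exp (σ * z.1))

lemma wave_eq_zero {σ : ℂ} {χ : ℝ → ℝ} (hχ : ∀ y ≤ M, χ y = 0) (z : ℝ × ℝ) (hz : z.2 ≤ M) :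
    wave σ χ z = 0 := by
  simp [wave, hχ _ hz]

/-- The height argument of `coeffN` is not tied to the top: with `y` in its place and a function on
the cell instead of a trace, it is the mode at height `y`. -/
lemma coeffN_eq (hΛ : 0 < Λ) (w : ℝ × ℝ → ℂ) (n : ℤ) (y : ℝ) :
    ∫ x in Ioo 0 Λ, w (x, y) * Complex.exp (-(Complex.I * alphaN Λ α n) * x) =
      Λ * coeffN Λ y α w n := by
  have : (Λ : ℂ) ≠ 0 := by exact_mod_cast hΛ.ne'
  rw [coeffN, ← mul_assoc, mul_one_div_cancel this, one_mul]
  simp only [neg_mul]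

lemma integrableOn_strip_mul (hM : ∀ x, f x < M) {w v : ℝ × ℝ → ℂ}
    (hw : MemLp w 2 (volume.restrict (cell Λ f b)))
    (hv : MemLp v 2 (volume.restrict (cell Λ f b))) :
    IntegrableOn (fun z => w z * v z) (Ioo 0 Λ ×ˢ Ioo M b) :=
  (hw.integrable_mul hv).mono_measure (Measure.restrict_mono (strip_subset_cell hM) le_rfl)

lemma setIntegral_cell_mul_wave (hf : Continuous f) (hc : ∀ x, c ≤ f x) (hM : ∀ x, f x < M)
    (hΛ : 0 < Λ) {w : ℝ × ℝ → ℂ} (hw : MemLp w 2 (volume.restrict (cell Λ f b)))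
    {χ : ℝ → ℝ} (hχ : Continuous χ) (h0 : ∀ y ≤ M, χ y = 0) (n : ℤ) :
    ∫ z in cell Λ f b, w z * wave (-(Complex.I * alphaN Λ α n)) χ z =
      Λ * ∫ y in Ioo M b, coeffN Λ y α w n * χ y := by
  have hi := integrableOn_strip_mul hM hw
    (memLp_cell_of_continuous (continuous_wave (σ := -(Complex.I * alphaN Λ α n)) hχ) hf hc 2)
  rw [setIntegral_cell_eq_strip hf hM fun z hz => by rw [wave_eq_zero h0 z hz, mul_zero],
    setIntegral_strip_symm _ hi, ← integral_const_mul]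
  refine integral_congr_ae (Filter.Eventually.of_forall fun y => ?_)
  simp only [← mul_assoc, ← coeffN_eq hΛ, ← integral_mul_const]
  refine integral_congr_ae (Filter.Eventually.of_forall fun x => ?_)
  simp only [wave]
  ring

lemma integrableOn_coeffN (hf : Continuous f) (hc : ∀ x, c ≤ f x) (hM : ∀ x, f x < M)
    (hΛ : 0 < Λ) {w : ℝ × ℝ → ℂ} (hw : MemLp w 2 (volume.restrict (cell Λ f b))) (n : ℤ) :
    IntegrableOn (fun y => coeffN Λ y α w n) (Ioo M b) := by
  have hi := integrableOn_strip_mul hM hw (memLp_cell_of_continuous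
    (continuous_wave (σ := -(Complex.I * alphaN Λ α n)) (χ := fun _ => 1) continuous_const) hf hc 2)
  rw [IntegrableOn, Measure.volume_eq_prod, ← Measure.prod_restrict] at hi
  have := hi.integral_prod_right.const_mul (Λ : ℂ)⁻¹
  refine this.congr (Filter.Eventually.of_forall fun y => ?_)
  have h : (Λ : ℂ) ≠ 0 := by exact_mod_cast hΛ.ne'
  simp only [wave, Complex.ofReal_one, one_mul, coeffN_eq hΛ]
  field_simp

lemma integrableOn_coeffN_mul (hf : Continuous f) (hc : ∀ x, c ≤ f x) (hM : ∀ x, f x < M)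
    (hΛ : 0 < Λ) {w : ℝ × ℝ → ℂ} (hw : MemLp w 2 (volume.restrict (cell Λ f b))) (n : ℤ)
    {χ : ℝ → ℝ} (hχ : Continuous χ) :
    IntegrableOn (fun y => coeffN Λ y α w n * χ y) (Ioo M b) := by
  obtain ⟨C, hC⟩ := (isCompact_Icc (a := M) (b := b)).exists_bound_of_continuousOn hχ.continuousOn
  refine (integrableOn_coeffN hf hc hM hΛ hw n).mul_bdd (c := C)
    (Complex.continuous_ofReal.comp hχ).aestronglyMeasurable ?_
  filter_upwards [ae_restrict_mem measurableSet_Ioo] with y hy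
  simpa using hC y (Ioo_subset_Icc_self hy)

lemma deriv_eq_zero_of_le {χ : ℝ → ℝ} (hχ : ContDiff ℝ ∞ χ) (h0 : ∀ y ≤ M, χ y = 0) {y : ℝ}
    (hy : y ≤ M) : deriv χ y = 0 := by
  have h1 := (hχ.differentiable (by simp) y).hasDerivAt.hasDerivWithinAt (s := Iic y)
  have h2 : HasDerivWithinAt χ 0 (Iic y) y :=
    (hasDerivWithinAt_const y (Iic y) (0 : ℝ)).congr (fun s hs => h0 s (le_trans hs hy)) (h0 y hy)
  exact (uniqueDiffWithinAt_Iic y).eq_deriv _ h1 h2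

lemma MemLp.integrable_mul_fun {X : Type*} [MeasurableSpace X] {μ : Measure X} {u v : X → ℂ}
    (hu : MemLp u 2 μ) (hv : MemLp v 2 μ) : Integrable (fun x => u x * v x) μ :=
  hu.integrable_mul hv

section modes

variable {u u₁ u₂ t : ℝ × ℝ → ℂ}

/-- `α_n Λ` and `α Λ` differ by `2πn`, so every mode has the same quasi-periodicity phase. -/
lemma exp_alphaN_mul (hΛ : 0 < Λ) (n : ℤ) :
    Complex.exp (-(Complex.I * alphaN Λ α n) * Λ) = Complex.exp (-(Complex.I * α * Λ)) := by
  have h : (Λ : ℂ) ≠ 0 := by exact_mod_cast hΛ.ne'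
  rw [Complex.exp_eq_exp_iff_exists_int]
  refine ⟨-n, ?_⟩
  simp only [alphaN]
  push_cast
  field_simp
  ring

/-- The Fourier modes of the vertical derivative are the derivatives of the Fourier modes. -/
lemma weak_coeffN_vertical (hf : Continuous f) (hc : ∀ x, c ≤ f x) (hM : ∀ x, f x < M)
    (hMb : M < b) (hΛ : 0 < Λ) (hu : MemH1Sqp Λ f b α u u₁ u₂ t) (n : ℤ) {χ : ℝ → ℝ}
    (hχ : ContDiff ℝ ∞ χ) (h0 : ∀ y ≤ M, χ y = 0) :
    ∫ y in Ioo M b, (coeffN Λ y α u n * deriv χ y + coeffN Λ y α u₂ n * χ y) =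
      coeffN Λ b α t n * χ b := by
  have hb : ∀ x, f x < b := fun x => (hM x).trans hMb
  have hχ' : Continuous (deriv χ) := (contDiff_infty_iff_deriv.1 hχ).2.continuous
  have hg := hu.isTrace.green₂_smooth hc hb hf
    (contDiff_wave (σ := -(Complex.I * alphaN Λ α n)) hχ)
  have m := fun {χ : ℝ → ℝ} (h : Continuous χ) =>
    memLp_cell_of_continuous (b := b) (Λ := Λ)
      (continuous_wave (σ := -(Complex.I * alphaN Λ α n)) h) hf hc 2
  simp only [partial₂_wave hχ] at hg
  rw [integral_add (MemLp.integrable_mul_fun hu.memH1.memLp (m hχ'))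
    (MemLp.integrable_mul_fun hu.memH1.memLp₂ (m hχ.continuous)),
    setIntegral_cell_mul_wave hf hc hM hΛ hu.memH1.memLp hχ'
      (fun y hy => deriv_eq_zero_of_le hχ h0 hy),
    setIntegral_cell_mul_wave hf hc hM hΛ hu.memH1.memLp₂ hχ.continuous h0] at hg
  have e1 : ∀ x, wave (-(Complex.I * alphaN Λ α n)) χ (x, f x) = 0 := fun x =>
    wave_eq_zero h0 (x, f x) (hM x).le
  simp only [e1, mul_zero, integral_zero, sub_zero] at hg
  have e2 : ∫ x in Ioo 0 Λ, t (x, b) * wave (-(Complex.I * alphaN Λ α n)) χ (x, b) =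
      Λ * coeffN Λ b α t n * χ b := by
    rw [← coeffN_eq hΛ, ← integral_mul_const]
    refine integral_congr_ae (Filter.Eventually.of_forall fun x => ?_)
    simp only [wave]
    ring
  have h : (Λ : ℂ) ≠ 0 := by exact_mod_cast hΛ.ne'
  rw [integral_add (integrableOn_coeffN_mul hf hc hM hΛ hu.memH1.memLp n hχ')
    (integrableOn_coeffN_mul hf hc hM hΛ hu.memH1.memLp₂ n hχ.continuous)]
  refine mul_left_cancel₀ h ?_
  rw [mul_add, hg, e2, mul_assoc]

/-- The Fourier modes of the horizontal derivative. -/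
lemma ae_coeffN_horizontal (hf : Continuous f) (hc : ∀ x, c ≤ f x) (hM : ∀ x, f x < M)
    (hMb : M < b) (hΛ : 0 < Λ) (hper : f Λ = f 0) (hu : MemH1Sqp Λ f b α u u₁ u₂ t) (n : ℤ) :
    ∀ᵐ y, y ∈ Ioo M b → coeffN Λ y α u₁ n = Complex.I * alphaN Λ α n * coeffN Λ y α u n := by
  have hb : ∀ x, f x < b := fun x => (hM x).trans hMb
  set σ : ℂ := -(Complex.I * alphaN Λ α n) with hσ
  have iU := integrableOn_coeffN (α := α) hf hc hM hΛ hu.memH1.memLp n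
  have iV := integrableOn_coeffN (α := α) hf hc hM hΛ hu.memH1.memLp₁ n
  have hloc : IntegrableOn (fun y => σ * coeffN Λ y α u n + coeffN Λ y α u₁ n) (Ioo M b) :=
    (iU.const_mul σ).add iV
  have key := isOpen_Ioo.ae_eq_zero_of_integral_contDiff_smul_eq_zero (μ := volume) (U := Ioo M b)
    (f := fun y => σ * coeffN Λ y α u n + coeffN Λ y α u₁ n) hloc.locallyIntegrableOn ?_
  · filter_upwards [key] with y hy hy'
    have := hy hy'
    rw [hσ] at this
    linear_combination this
  intro χ hχ _ h3
  have h0 : ∀ y, y ∉ Ioo M b → χ y = 0 := fun y hy =>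
    image_eq_zero_of_notMem_tsupport fun h => hy (h3 h)
  have h0M : ∀ y ≤ M, χ y = 0 := fun y hy => h0 y fun h => absurd h.1 (not_lt.2 hy)
  have hg := hu.isTrace.green₁_smooth hc hb hΛ hf (contDiff_wave (σ := σ) hχ)
  have m := memLp_cell_of_continuous (b := b) (Λ := Λ)
      (continuous_wave (σ := σ) hχ.continuous) hf hc 2
  simp only [partial₁_wave hχ] at hg
  have hi : Integrable (fun z => u z * (σ * wave σ χ z)) (volume.restrict (cell Λ f b)) := by
    refine ((hu.memH1.memLp.integrable_mul m).const_mul σ).congr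
      (Filter.Eventually.of_forall fun z => ?_)
    simp only [Pi.mul_apply]; ring
  have hcm : ∫ z in cell Λ f b, u z * (σ * wave σ χ z) =
      σ * ∫ z in cell Λ f b, u z * wave σ χ z := by
    rw [← integral_const_mul]
    refine integral_congr_ae (Filter.Eventually.of_forall fun z => ?_)
    ring
  rw [integral_add hi (MemLp.integrable_mul_fun hu.memH1.memLp₁ m), hcm,
    setIntegral_cell_mul_wave hf hc hM hΛ hu.memH1.memLp hχ.continuous h0M,
    setIntegral_cell_mul_wave hf hc hM hΛ hu.memH1.memLp₁ hχ.continuous h0M] at hg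
  have e1 : ∀ x, wave σ χ (x, f x) = 0 := fun x => wave_eq_zero h0M (x, f x) (hM x).le
  -- The wave has the phase opposite to that of the trace, so their product is periodic and the two
  -- lateral terms cancel.
  have e2 : ∫ y in Ioo (f Λ) b, t (Λ, y) * wave σ χ (Λ, y) =
      ∫ y in Ioo (f 0) b, t (0, y) * wave σ χ (0, y) := by
    rw [hper]
    refine integral_congr_ae ?_
    filter_upwards [hu.quasiperiodic] with y hy
    simp only [wave, hy, hσ, exp_alphaN_mul hΛ]
    simp only [Complex.ofReal_zero, mul_zero, Complex.exp_zero]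
    ring
  simp only [e1, e2, mul_zero, zero_mul, integral_zero, zero_add, sub_self] at hg
  have h : (Λ : ℂ) ≠ 0 := by exact_mod_cast hΛ.ne'
  have iUχ := integrableOn_coeffN_mul (α := α) hf hc hM hΛ hu.memH1.memLp n hχ.continuous
  have iVχ := integrableOn_coeffN_mul (α := α) hf hc hM hΛ hu.memH1.memLp₁ n hχ.continuous
  have : ∫ y, χ y • (σ * coeffN Λ y α u n + coeffN Λ y α u₁ n) =
      ∫ y in Ioo M b, (σ * (coeffN Λ y α u n * χ y) + coeffN Λ y α u₁ n * χ y) := by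
    rw [← setIntegral_eq_integral_of_forall_compl_eq_zero (s := Ioo M b) fun y hy => by
      simp [h0 y hy]]
    refine integral_congr_ae (Filter.Eventually.of_forall fun y => ?_)
    simp only [Complex.real_smul]
    ring
  rw [this, integral_add (iUχ.const_mul σ) iVχ, integral_const_mul]
  refine mul_left_cancel₀ h ?_
  linear_combination hg

lemma integral_exp_mul_exp (hΛ : 0 < Λ) (n m : ℤ) :
    ∫ x in Ioo 0 Λ, Complex.exp (Complex.I * alphaN Λ α n * (x : ℝ)) *
      Complex.exp (-(Complex.I * alphaN Λ α m * (x : ℝ))) = if m = n then (Λ : ℂ) else 0 := by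
  simp only [← Complex.exp_add]
  split_ifs with h
  · subst h
    simp [hΛ.le]
  · have hΛ' : (Λ : ℂ) ≠ 0 := by exact_mod_cast hΛ.ne'
    set τ : ℂ := Complex.I * alphaN Λ α n - Complex.I * alphaN Λ α m with hτ
    have hτ' : τ = 2 * Real.pi * Complex.I * ((n - m : ℤ) : ℂ) / Λ := by
      simp only [hτ, alphaN]; push_cast; field_simp; ring
    have hτ0 : τ ≠ 0 := by
      rw [hτ']
      have : ((n - m : ℤ) : ℂ) ≠ 0 := by exact_mod_cast sub_ne_zero.2 (Ne.symm h)
      refine div_ne_zero (mul_ne_zero ?_ this) hΛ'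
      exact Complex.two_pi_I_ne_zero
    have e : ∀ x : ℝ, Complex.I * alphaN Λ α n * x + -(Complex.I * alphaN Λ α m * x) = τ * x :=
      fun x => by rw [hτ]; ring
    simp only [e]
    rw [← integral_Ioc_eq_integral_Ioo, ← intervalIntegral.integral_of_le hΛ.le,
      integral_exp_mul_complex hτ0]
    have : Complex.exp (τ * Λ) = 1 := by
      rw [Complex.exp_eq_one_iff]
      exact ⟨n - m, by rw [hτ']; field_simp⟩
    rw [this]
    simp

end modes

end Grating

/-! ### The mode equation, conservation of energy and Parseval's identity. -/

namespace Grating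

variable {Λ b c α k M : ℝ} {f : ℝ → ℝ} {u u₁ u₂ t : ℝ × ℝ → ℂ} {g : ℝ → ℂ}

lemma conj_wave (a : ℝ) (χ : ℝ → ℝ) (z : ℝ × ℝ) :
    conj (wave (Complex.I * a) χ z) = wave (-(Complex.I * a)) χ z := by
  simp only [wave, map_mul, Complex.conj_ofReal, ← Complex.exp_conj, Complex.conj_I]
  ring_nf

lemma coeffN_wave (hΛ : 0 < Λ) (χ : ℝ → ℝ) (n m : ℤ) :
    coeffN Λ b α (wave (Complex.I * alphaN Λ α n) χ) m = if m = n then (χ b : ℂ) else 0 := by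
  have h : (Λ : ℂ) ≠ 0 := by exact_mod_cast hΛ.ne'
  simp only [coeffN, wave, mul_assoc (χ b : ℂ), integral_const_mul, integral_exp_mul_exp hΛ]
  split_ifs
  · field_simp
  · simp

/-- The variational problem tested with functions `χ(x₂) exp(i α_n x₁)`. -/
lemma weak_coeffN_variational (hf : Continuous f) (hc : ∀ x, c ≤ f x) (hM : ∀ x, f x < M)
    (hMb : M < b) (hΛ : 0 < Λ) (hu : MemH1Sqp Λ f b α u u₁ u₂ t)
    (hvar : ∀ v v₁ v₂ r : ℝ × ℝ → ℂ, MemH1Sqp Λ f b α v v₁ v₂ r →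
      ∃ s : ℂ, IsDtNPairing Λ k b α t r s ∧
        (∫ x in cell Λ f b, (u₁ x * conj (v₁ x) + u₂ x * conj (v₂ x)))
          - (k : ℂ) ^ 2 * (∫ x in cell Λ f b, u x * conj (v x)) - s
        = ∫ x in Ioo 0 Λ, g x * conj (r (x, b)))
    (n : ℤ) {χ : ℝ → ℝ} (hχ : ContDiff ℝ ∞ χ) (h0 : ∀ y ≤ M, χ y = 0) :
    ∫ y in Ioo M b, (coeffN Λ y α u₂ n * deriv χ y +
        (-(Complex.I * alphaN Λ α n) * coeffN Λ y α u₁ n - k ^ 2 * coeffN Λ y α u n) * χ y) =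
      (Complex.I * betaN Λ k α n * coeffN Λ b α t n + coeffN Λ b α (fun z => g z.1) n) * χ b := by
  have h : (Λ : ℂ) ≠ 0 := by exact_mod_cast hΛ.ne'
  set σ : ℂ := -(Complex.I * alphaN Λ α n) with hσ
  have hχ' : Continuous (deriv χ) := (contDiff_infty_iff_deriv.1 hχ).2.continuous
  have hv := memH1Sqp_of_contDiff (α := α) hf hc hM hMb hΛ
    (contDiff_wave (σ := Complex.I * alphaN Λ α n) hχ) (wave_eq_zero h0) fun y => by
      simp only [wave, Complex.ofReal_zero, mul_zero, Complex.exp_zero]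
      rw [mul_assoc, ← exp_alphaN_mul hΛ n, ← Complex.exp_add, neg_mul, add_neg_cancel,
        Complex.exp_zero]
  obtain ⟨s, hs, e⟩ := hvar _ _ _ _ hv
  -- The test function has only its `n`-th coefficient on the top, so the series of the pairing
  -- reduces to one term.
  have hs' : s = Λ * (Complex.I * betaN Λ k α n * coeffN Λ b α t n) * χ b := by
    refine hs.unique ?_
    simp only [coeffN_wave hΛ]
    convert hasSum_single (n : ℤ) ?_ using 1
    · simp
    · intro m hm
      simp [hm]
  simp only [partial₁_wave hχ, partial₂_wave hχ, map_mul, conj_wave, Complex.conj_I,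
    Complex.conj_ofReal] at e
  have w1 := memLp_cell_of_continuous (b := b) (Λ := Λ)
      (continuous_wave (σ := σ) hχ.continuous) hf hc 2
  have w2 := memLp_cell_of_continuous (b := b) (Λ := Λ)
      (continuous_wave (σ := σ) hχ') hf hc 2
  have e1 : ∀ z, u₁ z * (-Complex.I * alphaN Λ α n * wave σ χ z) = σ * (u₁ z * wave σ χ z) :=
    fun z => by rw [hσ]; ring
  simp only [← hσ, e1] at e
  rw [integral_add ((MemLp.integrable_mul_fun hu.memH1.memLp₁ w1).const_mul σ)
    (MemLp.integrable_mul_fun hu.memH1.memLp₂ w2), integral_const_mul,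
    setIntegral_cell_mul_wave hf hc hM hΛ hu.memH1.memLp₁ hχ.continuous h0,
    setIntegral_cell_mul_wave hf hc hM hΛ hu.memH1.memLp hχ.continuous h0,
    setIntegral_cell_mul_wave hf hc hM hΛ hu.memH1.memLp₂ hχ'
      (fun y hy => deriv_eq_zero_of_le hχ h0 hy), hs'] at e
  have e2 : ∫ x in Ioo 0 Λ, g x * wave σ χ (x, b) =
      Λ * coeffN Λ b α (fun z => g z.1) n * χ b := by
    rw [← coeffN_eq hΛ, ← integral_mul_const]
    refine integral_congr_ae (Filter.Eventually.of_forall fun x => ?_)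
    simp only [wave, hσ]
    ring
  rw [e2] at e
  have iU := integrableOn_coeffN_mul (α := α) hf hc hM hΛ hu.memH1.memLp n hχ.continuous
  have iV := integrableOn_coeffN_mul (α := α) hf hc hM hΛ hu.memH1.memLp₁ n hχ.continuous
  have iW := integrableOn_coeffN_mul (α := α) hf hc hM hΛ hu.memH1.memLp₂ n hχ'
  have e3 : ∀ y, coeffN Λ y α u₂ n * deriv χ y +
        (σ * coeffN Λ y α u₁ n - k ^ 2 * coeffN Λ y α u n) * χ y =
      coeffN Λ y α u₂ n * deriv χ y + σ * (coeffN Λ y α u₁ n * χ y) -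
        k ^ 2 * (coeffN Λ y α u n * χ y) := fun y => by ring
  simp only [e3]
  have i1 : IntegrableOn (fun y => coeffN Λ y α u₂ n * deriv χ y +
    σ * (coeffN Λ y α u₁ n * χ y)) (Ioo M b) := iW.add (iV.const_mul σ)
  rw [integral_sub i1 (iU.const_mul _), integral_add iW (iV.const_mul σ), integral_const_mul,
    integral_const_mul]
  refine mul_left_cancel₀ h ?_
  linear_combination e

/-- The Rellich energy of a Fourier mode is constant above the surface. -/
lemma ae_mode_energy (hf : Continuous f) (hc : ∀ x, c ≤ f x) (hM : ∀ x, f x < M)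
    (hMb : M < b) (hΛ : 0 < Λ) (hper : f Λ = f 0) (hu : MemH1Sqp Λ f b α u u₁ u₂ t)
    (hvar : ∀ v v₁ v₂ r : ℝ × ℝ → ℂ, MemH1Sqp Λ f b α v v₁ v₂ r →
      ∃ s : ℂ, IsDtNPairing Λ k b α t r s ∧
        (∫ x in cell Λ f b, (u₁ x * conj (v₁ x) + u₂ x * conj (v₂ x)))
          - (k : ℂ) ^ 2 * (∫ x in cell Λ f b, u x * conj (v x)) - s
        = ∫ x in Ioo 0 Λ, g x * conj (r (x, b)))
    (n : ℤ) :
    ∀ᵐ y, y ∈ Ioo M b →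
      ‖coeffN Λ y α u₂ n‖ ^ 2 - ‖coeffN Λ y α u₁ n‖ ^ 2 + k ^ 2 * ‖coeffN Λ y α u n‖ ^ 2 =
      ‖Complex.I * betaN Λ k α n * coeffN Λ b α t n + coeffN Λ b α (fun z => g z.1) n‖ ^ 2 +
        (k ^ 2 - alphaN Λ α n ^ 2) * ‖coeffN Λ b α t n‖ ^ 2 := by
  have iU := integrableOn_coeffN (α := α) hf hc hM hΛ hu.memH1.memLp n
  have iW := integrableOn_coeffN (α := α) hf hc hM hΛ hu.memH1.memLp₂ n
  have hV := ae_coeffN_horizontal hf hc hM hMb hΛ hper hu n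
  have h1 := ae_eq_sub_integral_of_weak (coeffN Λ b α t n) iU iW fun χ hχ h0 =>
    weak_coeffN_vertical hf hc hM hMb hΛ hu n hχ h0
  -- The variational equation says that the mode of `u₂` has weak derivative `-(k² - α_n²)` times
  -- the mode of `u`, with the Neumann datum `Tu + g` of that mode as its value at the top.
  have h2 := ae_eq_sub_integral_of_weak
    (W := fun y => -((k ^ 2 - alphaN Λ α n ^ 2 : ℝ) : ℂ) * coeffN Λ y α u n)
    (Complex.I * betaN Λ k α n * coeffN Λ b α t n + coeffN Λ b α (fun z => g z.1) n) iW
    (iU.const_mul _) fun χ hχ h0 => by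
      rw [← weak_coeffN_variational hf hc hM hMb hΛ hu hvar n hχ h0]
      refine setIntegral_congr_ae measurableSet_Ioo ?_
      filter_upwards [hV] with y hy hy'
      rw [hy hy']
      push_cast
      linear_combination ((alphaN Λ α n : ℂ) ^ 2 * coeffN Λ y α u n * χ y) * Complex.I_sq
  -- The mode of `u₁` is `i α_n` times that of `u`, so the conserved quantity is exactly the Rellich
  -- density of the mode.
  filter_upwards [ae_energy_eq h1 iW h2, hV] with y hy hy2 hy'
  rw [← hy hy', hy2 hy', norm_mul, norm_mul, Complex.norm_I, one_mul, Complex.norm_real, mul_pow,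
    Real.norm_eq_abs, sq_abs]
  ring

/-- Parseval's identity for quasi-periodic Fourier coefficients. -/
lemma hasSum_coeffN (hΛ : 0 < Λ) {w : ℝ × ℝ → ℂ} {y : ℝ}
    (hw : MemLp (fun x => w (x, y)) 2 (volume.restrict (Ioo 0 Λ))) :
    HasSum (fun n => ‖coeffN Λ y α w n‖ ^ 2) (Λ⁻¹ * ∫ x in Ioo 0 Λ, ‖w (x, y)‖ ^ 2) := by
  have hn : ∀ x : ℝ, ‖Complex.exp (-(Complex.I * α * x))‖ = 1 := fun x => by
    rw [show -(Complex.I * (α : ℂ) * x) = ((-(α * x) : ℝ) : ℂ) * Complex.I by push_cast; ring]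
    exact Complex.norm_exp_ofReal_mul_I _
  -- Removing the phase `exp(iαx)` turns the quasi-periodic coefficients into ordinary Fourier
  -- coefficients on `(0, Λ)`, without changing the modulus.
  have hF : MemLp (fun x => w (x, y) * Complex.exp (-(Complex.I * α * x))) 2
      (volume.restrict (Ioc 0 Λ)) := by
    rw [restrict_Ioo_eq_restrict_Ioc] at hw
    refine MemLp.of_le hw (hw.1.mul ?_) (Filter.Eventually.of_forall fun x => ?_)
    · exact (by fun_prop : Continuous fun x : ℝ =>
        Complex.exp (-(Complex.I * α * x))).aestronglyMeasurable
    · rw [norm_mul, hn, mul_one]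
  have := hasSum_sq_fourierCoeffOn hΛ hF
  rw [sub_zero, intervalIntegral.integral_of_le hΛ.le, integral_Ioc_eq_integral_Ioo,
    smul_eq_mul] at this
  simp only [norm_mul, hn, mul_one] at this
  convert this using 4 with n
  rw [fourierCoeffOn_eq_integral, intervalIntegral.integral_of_le hΛ.le,
    integral_Ioc_eq_integral_Ioo, coeffN, sub_zero, Complex.real_smul]
  push_cast
  congr 1
  refine integral_congr_ae (Filter.Eventually.of_forall fun x => ?_)
  have h : (Λ : ℂ) ≠ 0 := by exact_mod_cast hΛ.ne'
  simp only [fourier_coe_apply, smul_eq_mul]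
  rw [mul_left_comm, ← Complex.exp_add]
  congr 2
  simp only [alphaN]
  push_cast
  field_simp
  ring

lemma ae_memLp_slice (hM : ∀ x, f x < M) {w : ℝ × ℝ → ℂ}
    (hw : MemLp w 2 (volume.restrict (cell Λ f b))) :
    ∀ᵐ y, y ∈ Ioo M b → MemLp (fun x => w (x, y)) 2 (volume.restrict (Ioo 0 Λ)) := by
  have h : MemLp w 2 ((volume.restrict (Ioo 0 Λ)).prod (volume.restrict (Ioo M b))) := by
    rw [Measure.prod_restrict]
    exact hw.mono_measure (Measure.restrict_mono (strip_subset_cell hM) le_rfl)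
  rw [← ae_restrict_iff' measurableSet_Ioo]
  filter_upwards [h.1.prod_swap.prodMk_left, (MemLp.integrable_norm_sq h).prod_left_ae] with y h1 h2
  exact (memLp_two_iff_integrable_sq_norm h1).2 h2

/-- The horizontal mean of the Rellich energy density above the surface. -/
theorem ae_hasSum_energy (hf : Continuous f) (hc : ∀ x, c ≤ f x) (hM : ∀ x, f x < M)
    (hMb : M < b) (hΛ : 0 < Λ) (hper : f Λ = f 0) (hu : MemH1Sqp Λ f b α u u₁ u₂ t)
    (hvar : ∀ v v₁ v₂ r : ℝ × ℝ → ℂ, MemH1Sqp Λ f b α v v₁ v₂ r →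
      ∃ s : ℂ, IsDtNPairing Λ k b α t r s ∧
        (∫ x in cell Λ f b, (u₁ x * conj (v₁ x) + u₂ x * conj (v₂ x)))
          - (k : ℂ) ^ 2 * (∫ x in cell Λ f b, u x * conj (v x)) - s
        = ∫ x in Ioo 0 Λ, g x * conj (r (x, b))) :
    ∀ᵐ y, y ∈ Ioo M b → HasSum (fun n =>
      ‖Complex.I * betaN Λ k α n * coeffN Λ b α t n + coeffN Λ b α (fun z => g z.1) n‖ ^ 2 +
        (k ^ 2 - alphaN Λ α n ^ 2) * ‖coeffN Λ b α t n‖ ^ 2)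
      (Λ⁻¹ * ∫ x in Ioo 0 Λ, (‖u₂ (x, y)‖ ^ 2 - ‖u₁ (x, y)‖ ^ 2 + k ^ 2 * ‖u (x, y)‖ ^ 2)) := by
  have hall := ae_all_iff.2 (ae_mode_energy hf hc hM hMb hΛ hper hu hvar)
  filter_upwards [hall, ae_memLp_slice hM hu.memH1.memLp, ae_memLp_slice hM hu.memH1.memLp₁,
    ae_memLp_slice hM hu.memH1.memLp₂] with y hy m0 m1 m2 hy'
  have s0 := (hasSum_coeffN (α := α) hΛ (m0 hy')).mul_left (k ^ 2)
  have s1 := hasSum_coeffN (α := α) hΛ (m1 hy')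
  have s2 := hasSum_coeffN (α := α) hΛ (m2 hy')
  have := (s2.sub s1).add s0
  simp only [fun n => hy n hy'] at this
  rw [← integral_sub_add (MemLp.integrable_norm_sq (m2 hy')) (MemLp.integrable_norm_sq (m1 hy'))
    ((MemLp.integrable_norm_sq (m0 hy')).const_mul _), integral_const_mul, mul_add, mul_sub,
    mul_left_comm]
  exact this

end Grating

/-! ### From Rellich's inequality to data on the top. -/

namespace Grating

variable {Λ b c α k M : ℝ} {f : ℝ → ℝ} {u u₁ u₂ t : ℝ × ℝ → ℂ} {g : ℝ → ℂ}

lemma deriv_eq_one_of_le {m : ℝ → ℝ} (hm : ContDiff ℝ ∞ m) (h : ∀ y ≤ M, m y = y - c) {y : ℝ}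
    (hy : y ≤ M) : deriv m y = 1 := by
  have h1 := (hm.differentiable (by simp) y).hasDerivAt.hasDerivWithinAt (s := Iic y)
  have h2 : HasDerivWithinAt m 1 (Iic y) y :=
    ((hasDerivWithinAt_id y (Iic y)).sub_const c).congr (fun s hs => h s (le_trans hs hy)) (h y hy)
  exact (uniqueDiffWithinAt_Iic y).eq_deriv _ h1 h2

/-- A vertical vector field that equals `x₂ - c` below `M` and vanishes at `b`. -/
lemma exists_field (hcM : c ≤ M) (hMb : M < b) :
    ∃ m : ℝ → ℝ, ContDiff ℝ ∞ m ∧ m b = 0 ∧ (∀ y, c ≤ y → 0 ≤ m y) ∧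
      (∃ B, ∀ y, |deriv m y| ≤ B) ∧ (∀ y ≤ b, m y ≤ b - c) ∧ ∀ y ≤ M, m y = y - c := by
  set m : ℝ → ℝ := fun y => (y - c) * Real.smoothTransition ((b - y) / (b - M)) with hm
  have hd : 0 < b - M := sub_pos.2 hMb
  have hs : ContDiff ℝ ∞ m := by
    refine (contDiff_id.sub contDiff_const).mul (Real.smoothTransition.contDiff.comp ?_)
    exact (contDiff_const.sub contDiff_id).div_const _
  have hlow : ∀ y ≤ M, m y = y - c := fun y hy => by
    simp only [hm]
    rw [Real.smoothTransition.one_of_one_le, mul_one]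
    rw [one_le_div hd]; linarith
  have hhigh : ∀ y, b ≤ y → m y = 0 := fun y hy => by
    simp only [hm]
    rw [Real.smoothTransition.zero_of_nonpos, mul_zero]
    exact div_nonpos_of_nonpos_of_nonneg (by linarith) hd.le
  refine ⟨m, hs, hhigh b le_rfl, ?_, ?_, ?_, hlow⟩
  · exact fun y hy => mul_nonneg (by linarith) (Real.smoothTransition.nonneg _)
  · obtain ⟨C, hC⟩ := (isCompact_Icc (a := M) (b := b)).exists_bound_of_continuousOn
      (contDiff_infty_iff_deriv.1 hs).2.continuous.continuousOn
    refine ⟨max C 1, fun y => ?_⟩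
    rcases le_or_gt y M with h | h
    · rw [deriv_eq_one_of_le hs hlow h]; simp
    · rcases le_or_gt y b with h' | h'
      · exact (hC y ⟨h.le, h'⟩).trans (le_max_left _ _)
      · have : m =ᶠ[nhds y] fun _ => 0 := by
          filter_upwards [lt_mem_nhds h'] with z hz using hhigh z hz.le
        rw [this.deriv_eq]; simp
  · intro y hy
    rcases le_or_gt c y with h | h
    · exact (mul_le_of_le_one_right (by linarith) (Real.smoothTransition.le_one _)).trans
        (by linarith)
    · exact (mul_nonpos_of_nonpos_of_nonneg (by linarith)
        (Real.smoothTransition.nonneg _)).trans (by linarith)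

/-- The Rellich identity as an upper bound in terms of the Fourier modes on the top. -/
theorem integral_rellich_le (hf : Continuous f) (hc : ∀ x, c ≤ f x) (hM : ∀ x, f x < M)
    (hMb : M < b) (hΛ : 0 < Λ) (hper : f Λ = f 0) (hu : MemH1Sqp Λ f b α u u₁ u₂ t)
    (hvar : ∀ v v₁ v₂ r : ℝ × ℝ → ℂ, MemH1Sqp Λ f b α v v₁ v₂ r →
      ∃ s : ℂ, IsDtNPairing Λ k b α t r s ∧
        (∫ x in cell Λ f b, (u₁ x * conj (v₁ x) + u₂ x * conj (v₂ x)))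
          - (k : ℂ) ^ 2 * (∫ x in cell Λ f b, u x * conj (v x)) - s
        = ∫ x in Ioo 0 Λ, g x * conj (r (x, b))) :
    ∃ S, HasSum (fun n =>
      ‖Complex.I * betaN Λ k α n * coeffN Λ b α t n + coeffN Λ b α (fun z => g z.1) n‖ ^ 2 +
        (k ^ 2 - alphaN Λ α n ^ 2) * ‖coeffN Λ b α t n‖ ^ 2) S ∧
      (∫ z in cell Λ f b, ‖u₂ z‖ ^ 2) - (∫ z in cell Λ f b, ‖u₁ z‖ ^ 2) +
        k ^ 2 * (∫ z in cell Λ f b, ‖u z‖ ^ 2) ≤ (b - c) * (Λ * S) := by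
  have hb : ∀ x, f x < b := fun x => (hM x).trans hMb
  have hsum := ae_hasSum_energy hf hc hM hMb hΛ hper hu hvar
  set q : ℝ × ℝ → ℝ := fun z => ‖u₂ z‖ ^ 2 - ‖u₁ z‖ ^ 2 + k ^ 2 * ‖u z‖ ^ 2 with hq
  -- The terms do not depend on the height, so summability at a single good height in the strip
  -- provides `S`, and the horizontal mean is the same at almost every height.
  obtain ⟨S, hS⟩ : ∃ S, HasSum (fun n =>
      ‖Complex.I * betaN Λ k α n * coeffN Λ b α t n + coeffN Λ b α (fun z => g z.1) n‖ ^ 2 +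
        (k ^ 2 - alphaN Λ α n ^ 2) * ‖coeffN Λ b α t n‖ ^ 2) S := by
    have hne : (ae (volume.restrict (Ioo M b))).NeBot := by
      rw [ae_neBot, Ne, Measure.restrict_eq_zero]
      simp [hMb]
    obtain ⟨y, hy⟩ := ((ae_restrict_iff' measurableSet_Ioo).2 hsum).exists
    exact ⟨_, hy⟩
  refine ⟨S, hS, ?_⟩
  have hQ : ∀ᵐ y, y ∈ Ioo M b → ∫ x in Ioo 0 Λ, q (x, y) = Λ * S := by
    filter_upwards [hsum] with y hy hy'
    rw [← (hy hy').unique hS, mul_inv_cancel_left₀ hΛ.ne']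
  obtain ⟨m, hm, hmb, hm0, ⟨B, hB⟩, hmle, hmlow⟩ := exists_field ((hc 0).trans (hM 0).le) hMb
  have hrel := rellich hf hc hb hΛ hper hu hvar hm hmb hm0 hB hmle
  have i0 := MemLp.integrable_norm_sq hu.memH1.memLp
  have i1 := MemLp.integrable_norm_sq hu.memH1.memLp₁
  have i2 := MemLp.integrable_norm_sq hu.memH1.memLp₂
  have iq : Integrable q (volume.restrict (cell Λ f b)) := (i2.sub i1).add (i0.const_mul _)
  have hm' : Continuous (deriv m) := (contDiff_infty_iff_deriv.1 hm).2.continuous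
  have imq : Integrable (fun z => deriv m z.2 * q z) (volume.restrict (cell Λ f b)) :=
    iq.bdd_mul (c := B) (hm'.comp continuous_snd).aestronglyMeasurable
      (Filter.Eventually.of_forall fun z => by simpa using hB z.2)
  have inq : Integrable (fun z => (1 - deriv m z.2) * q z) (volume.restrict (cell Λ f b)) := by
    refine (iq.sub imq).congr (Filter.Eventually.of_forall fun z => ?_)
    simp only [Pi.sub_apply]; ring
  rw [← integral_const_mul, integral_sub_add i2 i1 (i0.const_mul _)]
  have hsplit : ∫ z in cell Λ f b, q z = (∫ z in cell Λ f b, (1 - deriv m z.2) * q z) +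
      ∫ z in cell Λ f b, deriv m z.2 * q z := by
    rw [← integral_add inq imq]
    refine integral_congr_ae (Filter.Eventually.of_forall fun z => ?_)
    ring
  -- `1 - m'` vanishes below `M`, and its integral over `(M, b)` is `(b - m b) - (M - m M) = b - c`.
  have hlayer : ∫ z in cell Λ f b, (1 - deriv m z.2) * q z = (b - c) * (Λ * S) := by
    rw [setIntegral_cell_eq_strip hf hM fun z hz => by
        rw [deriv_eq_one_of_le hm hmlow hz, sub_self, zero_mul],
      setIntegral_strip_symm _ (inq.mono_measure
        (Measure.restrict_mono (strip_subset_cell hM) le_rfl))]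
    simp only [integral_const_mul]
    have e : ∫ y in Ioo M b, (1 - deriv m y) * ∫ x in Ioo 0 Λ, q (x, y) =
        ∫ y in Ioo M b, (1 - deriv m y) * (Λ * S) := by
      refine setIntegral_congr_ae measurableSet_Ioo ?_
      filter_upwards [hQ] with y hy hy'
      rw [hy hy']
    rw [e, integral_mul_const, setIntegral_Ioo_deriv (F := fun y => y - m y) hMb.le
      (fun s => (hasDerivAt_id s).sub (hm.differentiable (by simp) s).hasDerivAt)
      (continuous_const.sub hm'), hmb, hmlow M le_rfl]
    ring
  change ∫ z in cell Λ f b, q z ≤ _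
  rw [hsplit, hlayer]
  linarith

lemma norm_integral_sq_le {X : Type*} [MeasurableSpace X] {μ : Measure X} [IsFiniteMeasure μ]
    {F : X → ℂ} (hF : MemLp F 2 μ) :
    ‖∫ x, F x ∂μ‖ ^ 2 ≤ μ.real univ * ∫ x, ‖F x‖ ^ 2 ∂μ := by
  have h : ‖∫ x, F x ∂μ‖ₑ ^ 2 ≤ μ univ * ∫⁻ x, ‖F x‖ₑ ^ 2 ∂μ :=
    (pow_le_pow_left' (enorm_integral_le_lintegral_enorm _) 2).trans
      (lintegral_sq_le μ hF.1.enorm)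
  have := ENNReal.toReal_mono (ENNReal.mul_ne_top (measure_ne_top _ _)
    (lintegral_enorm_sq_lt_top hF).ne) h
  rw [integral_norm_sq_eq_toReal hF.1]
  simpa [ENNReal.toReal_mul, ENNReal.toReal_pow, measureReal_def] using this

/-- The trace inequality for the zeroth Fourier coefficient. -/
lemma norm_coeffN_sq_le (hf : Continuous f) (hc : ∀ x, c ≤ f x) (hb : ∀ x, f x < b) (hΛ : 0 < Λ)
    (hu : MemH1Sqp Λ f b α u u₁ u₂ t) (n : ℤ) :
    (Λ * ‖coeffN Λ b α t n‖) ^ 2 ≤ Λ * (b - c) * ∫ z in cell Λ f b, ‖u₂ z‖ ^ 2 := by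
  have : IsFiniteMeasure (volume.restrict (cell Λ f b)) := ⟨by simpa using volume_cell_lt_top hc⟩
  have hcb : c < b := (hc 0).trans_lt (hb 0)
  set σ : ℂ := -(Complex.I * alphaN Λ α n) with hσ
  have hχ : ContDiff ℝ ∞ fun _ : ℝ => (1 : ℝ) := contDiff_const
  -- The wave is constant in `x₂` and the trace vanishes on the surface, so the top coefficient is
  -- an integral of `u₂` over the cell; Cauchy–Schwarz with the area of the enclosing rectangle
  -- finishes.
  have hg := hu.isTrace.green₂_smooth hc hb hf (contDiff_wave (σ := σ) hχ)
  have hsurf : ∫ x in Ioo 0 Λ, t (x, f x) * wave σ (fun _ => 1) (x, f x) = 0 := by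
    rw [integral_congr_ae (g := fun _ => 0), integral_zero]
    filter_upwards [hu.zero_on_surface] with x hx
    simp [hx]
  have hd : ∀ z, wave σ (deriv fun _ : ℝ => (1 : ℝ)) z = 0 := fun z => by simp [wave]
  have htop : ∫ x in Ioo 0 Λ, t (x, b) * wave σ (fun _ => 1) (x, b) = Λ * coeffN Λ b α t n := by
    rw [← coeffN_eq hΛ]
    simp [wave, hσ]
  simp only [partial₂_wave hχ, hd, mul_zero, zero_add, hsurf, htop, sub_zero] at hg
  have hn : ∀ z, ‖wave σ (fun _ => 1) z‖ = 1 := fun z => by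
    simp only [wave, hσ]
    rw [show -(Complex.I * (alphaN Λ α n : ℂ)) * (z.1 : ℂ) =
      ((-(alphaN Λ α n * z.1) : ℝ) : ℂ) * Complex.I by push_cast; ring]
    rw [norm_mul, Complex.norm_exp_ofReal_mul_I]
    simp
  have hmem : MemLp (fun z => u₂ z * wave σ (fun _ => 1) z) 2 (volume.restrict (cell Λ f b)) :=
    hu.memH1.memLp₂.of_le (hu.memH1.memLp₂.1.mul
      (continuous_wave (σ := σ) continuous_const).aestronglyMeasurable)
      (Filter.Eventually.of_forall fun z => by rw [norm_mul, hn, mul_one])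
  have key := norm_integral_sq_le hmem
  rw [hg] at key
  simp only [norm_mul, hn, mul_one, Complex.norm_real, Real.norm_of_nonneg hΛ.le] at key
  refine key.trans ?_
  gcongr
  rw [measureReal_def, Measure.restrict_apply_univ]
  refine (ENNReal.toReal_mono ?_ (measure_mono (cell_subset hc))).trans ?_
  · rw [Measure.volume_eq_prod, Measure.prod_prod]
    simp [ENNReal.mul_eq_top]
  · rw [Measure.volume_eq_prod, Measure.prod_prod, ENNReal.toReal_mul]
    simp [hΛ.le, hcb.le]

end Grating

/-! ### Energy bounds, the stability estimate and the theorem. -/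

namespace Grating

variable {Λ b c α k M θ : ℝ} {f : ℝ → ℝ} {u u₁ u₂ t : ℝ × ℝ → ℂ}

/-- `β_n` for the propagating modes, and zero for the evanescent ones. -/
noncomputable def propN (Λ k α : ℝ) (n : ℤ) : ℝ :=
  if |alphaN Λ α n| ≤ k then Real.sqrt (k ^ 2 - alphaN Λ α n ^ 2) else 0

lemma propN_nonneg (n : ℤ) : 0 ≤ propN Λ k α n := by
  unfold propN
  split_ifs
  · exact Real.sqrt_nonneg _
  · exact le_rfl

lemma propN_le (hk : 0 ≤ k) (n : ℤ) : propN Λ k α n ≤ k := by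
  unfold propN
  split_ifs
  · exact Real.sqrt_le_iff.2 ⟨hk, by nlinarith [sq_nonneg (alphaN Λ α n)]⟩
  · exact hk

lemma sq_le_of_abs_le {x : ℝ} (h : |x| ≤ k) : x ^ 2 ≤ k ^ 2 :=
  sq_le_sq' (by linarith [(abs_le.1 h).1]) (abs_le.1 h).2

lemma sq_le_of_lt_abs (hk : 0 ≤ k) {x : ℝ} (h : k < |x|) : k ^ 2 ≤ x ^ 2 := by
  rw [← sq_abs x]
  exact pow_le_pow_left₀ hk h.le 2

/-- `i β_n` is purely imaginary for a propagating mode and a nonpositive real number for an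
evanescent one. -/
lemma dtn_term (hΛ : 0 < Λ) (n : ℤ) (z : ℂ) :
    ((Λ : ℂ) * (Complex.I * betaN Λ k α n * z) * conj z).im = Λ * (propN Λ k α n * ‖z‖ ^ 2) ∧
      ((Λ : ℂ) * (Complex.I * betaN Λ k α n * z) * conj z).re ≤ 0 := by
  have e : (Λ : ℂ) * (Complex.I * betaN Λ k α n * z) * conj z =
      Complex.I * betaN Λ k α n * ((Λ * ‖z‖ ^ 2 : ℝ) : ℂ) := by
    have := Complex.mul_conj' z
    push_cast
    linear_combination (Λ : ℂ) * (Complex.I * betaN Λ k α n) * this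
  rw [e]
  unfold betaN propN
  split_ifs with h
  · simp only [Complex.mul_im, Complex.mul_re, Complex.I_re, Complex.I_im, Complex.ofReal_re,
      Complex.ofReal_im]
    constructor
    · ring
    · simp
  · rw [← mul_assoc, Complex.I_mul_I]
    simp only [Complex.mul_im, Complex.mul_re, Complex.ofReal_re, Complex.neg_re, Complex.neg_im,
      Complex.one_re, Complex.one_im, Complex.ofReal_im]
    constructor
    · simp
    · have := mul_nonneg (Real.sqrt_nonneg (alphaN Λ α n ^ 2 - k ^ 2))
        (mul_nonneg hΛ.le (sq_nonneg ‖z‖))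
      linarith

/-- For an evanescent mode without datum, `|β_n|² = α_n² - k²` makes the energy vanish. For a
propagating mode, `|iβz + G|² ≤ 2β²|z|² + 2|G|²` and `β² ≤ kβ` give the constant 3; the factor `k`
trades `β²` for the weight `β` of the outgoing energy. -/
lemma mode_energy_le (hk : 0 ≤ k) (n : ℤ) (z G : ℂ) (hG : ¬|alphaN Λ α n| ≤ k → G = 0) :
    ‖Complex.I * betaN Λ k α n * z + G‖ ^ 2 + (k ^ 2 - alphaN Λ α n ^ 2) * ‖z‖ ^ 2 ≤
      3 * k * (propN Λ k α n * ‖z‖ ^ 2) + 2 * ‖G‖ ^ 2 := by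
  by_cases h : |alphaN Λ α n| ≤ k
  · have hp : propN Λ k α n = Real.sqrt (k ^ 2 - alphaN Λ α n ^ 2) := if_pos h
    have hp2 : propN Λ k α n ^ 2 = k ^ 2 - alphaN Λ α n ^ 2 := by
      rw [hp, Real.sq_sqrt (sub_nonneg.2 (sq_le_of_abs_le h))]
    have hβ : betaN Λ k α n = (propN Λ k α n : ℂ) := by rw [hp]; exact if_pos h
    have hn : ‖Complex.I * betaN Λ k α n * z‖ = propN Λ k α n * ‖z‖ := by
      rw [hβ, norm_mul, norm_mul, Complex.norm_I, one_mul, Complex.norm_real,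
        Real.norm_of_nonneg (propN_nonneg n)]
    have h1 := norm_add_le (Complex.I * betaN Λ k α n * z) G
    rw [hn] at h1
    have h2 : ‖Complex.I * betaN Λ k α n * z + G‖ ^ 2 ≤
        2 * (propN Λ k α n * ‖z‖) ^ 2 + 2 * ‖G‖ ^ 2 := by
      refine (pow_le_pow_left₀ (norm_nonneg _) h1 2).trans ?_
      nlinarith [sq_nonneg (propN Λ k α n * ‖z‖ - ‖G‖)]
    have h3 : propN Λ k α n ^ 2 * ‖z‖ ^ 2 ≤ k * (propN Λ k α n * ‖z‖ ^ 2) := by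
      have := mul_le_mul_of_nonneg_right (propN_le (Λ := Λ) (α := α) hk n)
        (mul_nonneg (propN_nonneg (Λ := Λ) (k := k) (α := α) n) (sq_nonneg ‖z‖))
      linarith
    rw [← hp2]
    linarith [mul_pow (propN Λ k α n) ‖z‖ 2]
  · have hp : propN Λ k α n = 0 := if_neg h
    have h2 : k ^ 2 ≤ alphaN Λ α n ^ 2 := sq_le_of_lt_abs hk (not_le.1 h)
    have hβ : betaN Λ k α n = Complex.I * (Real.sqrt (alphaN Λ α n ^ 2 - k ^ 2) : ℂ) := if_neg h
    rw [hG h, hβ, hp, add_zero]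
    simp only [norm_mul, Complex.norm_I, one_mul, Complex.norm_real, mul_pow, Real.norm_eq_abs,
      sq_abs, Real.sq_sqrt (sub_nonneg.2 h2), norm_zero]
    apply le_of_eq
    ring

lemma alphaN_zero : alphaN Λ α 0 = α := by simp [alphaN]

lemma norm_incidentData (hk : 0 ≤ k) (hθ : 0 ≤ Real.cos θ) (x : ℝ) :
    ‖incidentData k θ b x‖ = 2 * (k * Real.cos θ) := by
  unfold incidentData
  rw [show Complex.I * ((k * Real.sin θ : ℝ) : ℂ) * (x : ℂ) -
      Complex.I * ((k * Real.cos θ : ℝ) : ℂ) * (b : ℂ) =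
      ((k * Real.sin θ * x - k * Real.cos θ * b : ℝ) : ℂ) * Complex.I by push_cast; ring,
    norm_mul, Complex.norm_exp_ofReal_mul_I, norm_mul, norm_mul, Complex.norm_I, Complex.norm_real,
    Real.norm_of_nonneg (mul_nonneg hk hθ)]
  norm_num

lemma incidentData_eq (x : ℝ) : incidentData k θ b x =
    incidentData k θ b 0 * Complex.exp (Complex.I * alphaN Λ (k * Real.sin θ) 0 * x) := by
  unfold incidentData
  rw [alphaN_zero, mul_assoc (_ * _ * _), ← Complex.exp_add]
  congr 2
  push_cast
  ring

lemma coeffN_incidentData (hΛ : 0 < Λ) (n : ℤ) :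
    coeffN Λ b (k * Real.sin θ) (fun z => incidentData k θ b z.1) n =
      if n = 0 then incidentData k θ b 0 else 0 := by
  have h : (Λ : ℂ) ≠ 0 := by exact_mod_cast hΛ.ne'
  have e (x : ℝ) : incidentData k θ b x *
      Complex.exp (-(Complex.I * alphaN Λ (k * Real.sin θ) n * x)) = incidentData k θ b 0 *
        (Complex.exp (Complex.I * alphaN Λ (k * Real.sin θ) 0 * x) *
          Complex.exp (-(Complex.I * alphaN Λ (k * Real.sin θ) n * x))) := by
    rw [← mul_assoc, ← incidentData_eq]
  simp only [coeffN, e, integral_const_mul, integral_exp_mul_exp hΛ]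
  split_ifs
  · field_simp
  · simp

lemma integral_incidentData_mul_conj (hΛ : 0 < Λ) :
    ∫ x in Ioo 0 Λ, incidentData k θ b x * conj (t (x, b)) =
      incidentData k θ b 0 * conj (Λ * coeffN Λ b (k * Real.sin θ) t 0) := by
  rw [← coeffN_eq hΛ, ← integral_conj, ← integral_const_mul]
  refine integral_congr_ae (Filter.Eventually.of_forall fun x => ?_)
  simp only
  rw [incidentData_eq (Λ := Λ) (θ := θ) x, map_mul, ← Complex.exp_conj]
  simp only [map_mul, map_neg, Complex.conj_I, Complex.conj_ofReal]
  ring_nf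

/-- Energy bounds from testing the problem with its solution, together with the Rellich
inequality. -/
theorem exists_energy_bounds (hf : Continuous f) (hc : ∀ x, c ≤ f x) (hM : ∀ x, f x < M)
    (hMb : M < b) (hΛ : 0 < Λ) (hper : f Λ = f 0) (hk : 0 ≤ k) (hθ : 0 ≤ Real.cos θ)
    (hu : IsSolution Λ f b k θ u u₁ u₂ t) :
    ∃ r, 0 ≤ r ∧
      r ≤ Real.sqrt (∫ x in Ioo 0 Λ, ‖incidentData k θ b x‖ ^ 2) * Real.sqrt (b - c) *
        Real.sqrt (∫ z in cell Λ f b, ‖u₂ z‖ ^ 2) ∧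
      (∫ z in cell Λ f b, ‖u₁ z‖ ^ 2) + (∫ z in cell Λ f b, ‖u₂ z‖ ^ 2) -
        k ^ 2 * (∫ z in cell Λ f b, ‖u z‖ ^ 2) ≤ r ∧
      (∫ z in cell Λ f b, ‖u₂ z‖ ^ 2) - (∫ z in cell Λ f b, ‖u₁ z‖ ^ 2) +
        k ^ 2 * (∫ z in cell Λ f b, ‖u z‖ ^ 2) ≤
        (b - c) * (3 * k * r + 2 * ∫ x in Ioo 0 Λ, ‖incidentData k θ b x‖ ^ 2) := by
  have hb : ∀ x, f x < b := fun x => (hM x).trans hMb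
  have hcb : c < b := (hc 0).trans_lt (hb 0)
  set α := k * Real.sin θ with hα
  set G := incidentData k θ b 0 with hG
  set T := coeffN Λ b α t with hT
  have hgn : ∫ x in Ioo 0 Λ, ‖incidentData k θ b x‖ ^ 2 = Λ * ‖G‖ ^ 2 := by
    simp only [hG, norm_incidentData hk hθ]
    simp [hΛ.le]
  -- The incident wave occupies mode zero, which always propagates, so evanescent modes carry no
  -- datum.
  have h0p : |alphaN Λ α 0| ≤ k := by
    rw [alphaN_zero, hα, abs_mul, abs_of_nonneg hk]
    exact mul_le_of_le_one_right hk (Real.abs_sin_le_one θ)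
  obtain ⟨s, hs, e⟩ := hu.variational _ _ _ _ hu.mem
  rw [integral_incidentData_mul_conj hΛ, ← hα, ← hG] at e
  have m0 := hu.mem.memH1.memLp
  have m1 := hu.mem.memH1.memLp₁
  have m2 := hu.mem.memH1.memLp₂
  have sq : ∀ z : ℂ, z * conj z = ((‖z‖ ^ 2 : ℝ) : ℂ) := fun z => by
    rw [Complex.mul_conj', Complex.ofReal_pow]
  rw [integral_add (MemLp.integrable_mul_conj m1 m1) (MemLp.integrable_mul_conj m2 m2)] at e
  simp only [sq] at e
  have ho : ∀ F : ℝ × ℝ → ℝ, ∫ z in cell Λ f b, (F z : ℂ) = ((∫ z in cell Λ f b, F z : ℝ) : ℂ) :=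
    fun F => integral_ofReal
  simp only [ho] at e
  have hre := congrArg Complex.re e
  have him := congrArg Complex.im e
  simp only [Complex.sub_re, Complex.sub_im, Complex.add_re, Complex.add_im,
    ← Complex.ofReal_pow, ← Complex.ofReal_mul, Complex.ofReal_re, Complex.ofReal_im,
    sub_zero, add_zero, zero_sub] at hre him
  set R := G * conj ((Λ : ℂ) * T 0) with hR
  have hRn : ‖R‖ = ‖G‖ * (Λ * ‖T 0‖) := by
    rw [hR, norm_mul, RCLike.norm_conj, norm_mul, Complex.norm_real, Real.norm_of_nonneg hΛ.le]
  have hsre : s.re ≤ 0 :=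
    (Complex.hasSum_re hs).nonpos fun n => (dtn_term hΛ n _).2
  have hsim : HasSum (fun n => Λ * (propN Λ k α n * ‖T n‖ ^ 2)) s.im := by
    have := Complex.hasSum_im hs
    simpa only [(dtn_term hΛ _ _).1] using this
  have hP : HasSum (fun n => propN Λ k α n * ‖T n‖ ^ 2) (Λ⁻¹ * s.im) := by
    have := hsim.mul_left Λ⁻¹
    simpa only [inv_mul_cancel_left₀ hΛ.ne'] using this
  refine ⟨‖R‖, norm_nonneg _, ?_, ?_, ?_⟩
  · rw [hRn, hgn, Real.sqrt_mul hΛ.le, Real.sqrt_sq (norm_nonneg _)]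
    have h1 := Real.sqrt_le_sqrt (norm_coeffN_sq_le hf hc hb hΛ hu.mem 0)
    rw [Real.sqrt_sq (by positivity), Real.sqrt_mul (by nlinarith), Real.sqrt_mul hΛ.le] at h1
    have := mul_le_mul_of_nonneg_left h1 (norm_nonneg G)
    linarith
  · have := Complex.re_le_norm R
    linarith
  · obtain ⟨S, hS, hle⟩ := integral_rellich_le hf hc hM hMb hΛ hper hu.mem hu.variational
    refine hle.trans (mul_le_mul_of_nonneg_left ?_ (by linarith))
    have hGs : HasSum (fun n : ℤ => 2 * ‖coeffN Λ b α (fun z => incidentData k θ b z.1) n‖ ^ 2)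
        (2 * ‖G‖ ^ 2) := by
      refine HasSum.mul_left 2 ?_
      convert hasSum_single (0 : ℤ) ?_ using 1
      · rw [coeffN_incidentData hΛ, if_pos rfl]
      · intro n hn
        rw [coeffN_incidentData hΛ, if_neg hn]; simp
    have hS' : S ≤ 3 * k * (Λ⁻¹ * s.im) + 2 * ‖G‖ ^ 2 := by
      refine hasSum_le (fun n => ?_) hS ((hP.mul_left (3 * k)).add hGs)
      refine mode_energy_le hk n _ _ fun hn => ?_
      rw [coeffN_incidentData hΛ, if_neg]
      rintro rfl
      exact hn h0p
    have h2 : s.im ≤ ‖R‖ := by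
      have := (abs_le.1 (Complex.abs_im_le_norm R)).1
      linarith
    calc Λ * S ≤ Λ * (3 * k * (Λ⁻¹ * s.im) + 2 * ‖G‖ ^ 2) := by gcongr
      _ = 3 * k * s.im + 2 * (Λ * ‖G‖ ^ 2) := by field_simp
      _ ≤ 3 * k * ‖R‖ + 2 * ∫ x in Ioo 0 Λ, ‖incidentData k θ b x‖ ^ 2 := by
        rw [hgn]; gcongr

/-- The elementary step from the energy inequalities to the stability estimate. -/
lemma stability_arith {N₀ N₁ N₂ r g L k : ℝ} (h2 : 0 ≤ N₂) (hL : 0 < L)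
    (hk : 0 ≤ k) (hg : 0 ≤ g) (hr : r ≤ g * √L * √N₂)
    (he : N₁ + N₂ - k ^ 2 * N₀ ≤ r) (hR : N₂ - N₁ + k ^ 2 * N₀ ≤ L * (3 * k * r + 2 * g ^ 2))
    (hP : N₀ ≤ L ^ 2 * N₂) :
    √(N₁ + N₂) + k * √N₀ ≤ ((2 * k * L + 1) * (3 * k * L + 2) + 1) * (√L * g) := by
  set X := √N₂ with hX
  set a := √L with ha
  have hX0 : 0 ≤ X := Real.sqrt_nonneg _
  have ha0 : 0 ≤ a := Real.sqrt_nonneg _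
  have hX2 : N₂ = X ^ 2 := (Real.sq_sqrt h2).symm
  have ha2 : L = a ^ 2 := (Real.sq_sqrt hL.le).symm
  have hag : 0 ≤ a * g := by positivity
  have hkL : 0 ≤ k * L := by positivity
  -- Adding `he` and `hR` eliminates `N₀` and `N₁` and leaves `2X² ≤ (3kL + 1) a g X + 2 (a g)²`,
  -- which fails for larger `X`.
  have hXle : X ≤ (3 * k * L + 2) * (a * g) := by
    by_contra! hcon
    have h1 : 2 * X ^ 2 ≤ (3 * (k * L) + 1) * (a * g * X) + 2 * (a * g) ^ 2 := by
      have e1 : r ≤ a * g * X := by linarith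
      have e2 : (3 * (k * L) + 1) * r ≤ (3 * (k * L) + 1) * (a * g * X) := by gcongr
      have e3 : (a * g) ^ 2 = L * g ^ 2 := by rw [ha2]; ring
      rw [e3, ← hX2]
      linarith
    have hX' : 2 * (a * g) ≤ X := by nlinarith [mul_nonneg hkL hag]
    have hXpos : 0 < X := by nlinarith [mul_nonneg hkL hag]
    have h3 : (3 * k * L + 2) * (a * g) * X < X * X := mul_lt_mul_of_pos_right hcon hXpos
    nlinarith [mul_le_mul hX' hX' (by positivity) hX0, mul_nonneg hag hX0]
  have hsN₀ : √N₀ ≤ L * X := by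
    refine (Real.sqrt_le_sqrt hP).trans (le_of_eq ?_)
    rw [Real.sqrt_mul (sq_nonneg L), Real.sqrt_sq hL.le]
  have hN₀ : k ^ 2 * N₀ ≤ (k * L * X) ^ 2 := by
    have := mul_le_mul_of_nonneg_left hP (sq_nonneg k)
    rw [hX2] at this
    linarith [show (k * L * X) ^ 2 = k ^ 2 * (L ^ 2 * X ^ 2) by ring]
  -- By the energy inequality `N₁ + N₂` is at most `k² N₀ + r ≤ (kLX)² + a g X`.
  have hsN : √(N₁ + N₂) ≤ k * L * X + a * g + X := by
    rw [Real.sqrt_le_left (by positivity)]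
    nlinarith [mul_nonneg hag hX0, mul_nonneg (mul_nonneg hkL hX0) hag,
      mul_nonneg (mul_nonneg hkL hX0) hX0, sq_nonneg (a * g), sq_nonneg X]
  have h4 : (2 * (k * L) + 1) * X ≤ (2 * (k * L) + 1) * ((3 * k * L + 2) * (a * g)) := by
    gcongr
  have h5 : k * √N₀ ≤ k * (L * X) := by gcongr
  linarith

theorem _root_.Function.Periodic.exists_bounds {f : ℝ → ℝ} (hΛ : 0 < Λ) (hf : Continuous f)
    (hper : Function.Periodic f Λ) : ∃ y z, ∀ x, f y ≤ f x ∧ f x ≤ f z := by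
  have hne : (Icc 0 Λ).Nonempty := nonempty_Icc.2 hΛ.le
  obtain ⟨y, -, hy⟩ := isCompact_Icc.exists_isMinOn hne hf.continuousOn
  obtain ⟨z, -, hz⟩ := isCompact_Icc.exists_isMaxOn hne hf.continuousOn
  refine ⟨y, z, fun x => ?_⟩
  obtain ⟨x', hx', e⟩ := hper.exists_mem_Ico₀ hΛ x
  rw [e]
  exact ⟨hy (Ico_subset_Icc_self hx'), hz (Ico_subset_Icc_self hx')⟩

end Grating

theorem theorem1 (Λ : ℝ) (hΛ : 0 < Λ) (f : ℝ → ℝ) (hf : ∃ K : NNReal, LipschitzWith K f)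
    (hper : Function.Periodic f Λ) :
    ∃ C : ℝ, 0 < C ∧ ∃ k₀ : ℝ, 0 < k₀ ∧
      ∀ k b θ ε : ℝ, k₀ ≤ k → 1 < b → (∀ x, f x < b) →
        θ ∈ Set.Ioo (-(Real.pi / 2)) (Real.pi / 2) →
        0 < ε → (∀ n : ℤ, ε ≤ |k - Grating.alphaN Λ (k * Real.sin θ) n|) →
        ∀ u u₁ u₂ t : ℝ × ℝ → ℂ, Grating.IsSolution Λ f b k θ u u₁ u₂ t →
          Real.sqrt (∫ x in Grating.cell Λ f b, (‖u₁ x‖ ^ 2 + ‖u₂ x‖ ^ 2))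
              + k * Real.sqrt (∫ x in Grating.cell Λ f b, ‖u x‖ ^ 2)
            ≤ C * max (b ^ 2 * k ^ 2 / Real.sqrt ε) (b ^ 3 * k ^ (5 / 2 : ℝ))
              * Real.sqrt (∫ x in Set.Ioo 0 Λ, ‖Grating.incidentData k θ b x‖ ^ 2) := by
  obtain ⟨κ, hκ⟩ := hf
  have hfc := hκ.continuous
  obtain ⟨y, z, hyz⟩ := hper.exists_bounds hΛ hfc
  set c := f y
  set K := 1 + |c|
  have hK1 : 1 ≤ K := by simp [K]
  -- Since `b > 1`, both `b - c` and its square root are at most `K b`. With `Q = k K b ≥ 1` the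
  -- polynomial factor is at most `6Q² + 7Q + 3 ≤ 16 Q²`, and the square root supplies the third
  -- power of `K b`.
  refine ⟨16 * K ^ 3, by positivity, 1, one_pos, ?_⟩
  intro k b θ ε hk hb1 hb hθ _ _ u u₁ u₂ t hu
  have hcos : 0 ≤ Real.cos θ := (Real.cos_pos_of_mem_Ioo hθ).le
  have hMf : ∀ x, f x < (f z + b) / 2 := fun x => by linarith [(hyz x).2, hb z]
  have hMb : (f z + b) / 2 < b := by linarith [hb z]
  have hper0 : f Λ = f 0 := by simpa using hper 0
  obtain ⟨r, -, hr, he, hR⟩ := Grating.exists_energy_bounds hfc (fun x => (hyz x).1) hMf hMb hΛ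
    hper0 (by linarith) hcos hu
  have hP := Grating.integral_norm_sq_le hfc (fun x => (hyz x).1) hb hu.mem
  set g := Real.sqrt (∫ x in Set.Ioo 0 Λ, ‖Grating.incidentData k θ b x‖ ^ 2)
  have hg2 : ∫ x in Set.Ioo 0 Λ, ‖Grating.incidentData k θ b x‖ ^ 2 = g ^ 2 :=
    (Real.sq_sqrt (by positivity)).symm
  rw [hg2] at hR
  have hL : 0 < b - c := sub_pos.2 (hb y)
  have key := Grating.stability_arith (by positivity) hL (by linarith)
    (Real.sqrt_nonneg _) hr he hR hP
  rw [← MeasureTheory.integral_add (Grating.MemLp.integrable_norm_sq hu.mem.memH1.memLp₁)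
    (Grating.MemLp.integrable_norm_sq hu.mem.memH1.memLp₂)] at key
  refine key.trans ?_
  have hg0 : 0 ≤ g := Real.sqrt_nonneg _
  have hLK : b - c ≤ K * b := by
    have h1 := neg_abs_le c
    have h2 : |c| * 1 ≤ |c| * b := by gcongr
    simp only [K]
    linarith
  have hKb : 1 ≤ K * b := by nlinarith
  have hsq : Real.sqrt (b - c) ≤ K * b := by
    rw [Real.sqrt_le_left (by positivity)]
    nlinarith
  have hkL : k * (b - c) ≤ k * (K * b) := by gcongr
  have hkL0 : 0 ≤ k * (b - c) := by positivity
  have hkK : 1 ≤ k * (K * b) := by nlinarith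
  have hfac : (2 * k * (b - c) + 1) * (3 * k * (b - c) + 2) + 1 ≤ 16 * (k * (K * b)) ^ 2 := by
    nlinarith [mul_le_mul hkL hkL hkL0 (by positivity)]
  have hpow : k ^ 2 ≤ k ^ (5 / 2 : ℝ) := by
    rw [← Real.rpow_natCast k 2]
    exact Real.rpow_le_rpow_of_exponent_le hk (by norm_num)
  calc ((2 * k * (b - c) + 1) * (3 * k * (b - c) + 2) + 1) * (Real.sqrt (b - c) * g)
      ≤ 16 * (k * (K * b)) ^ 2 * (K * b * g) := by gcongr
    _ = 16 * K ^ 3 * (b ^ 3 * k ^ 2) * g := by ring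
    _ ≤ 16 * K ^ 3 * (b ^ 3 * k ^ (5 / 2 : ℝ)) * g := by gcongr
    _ ≤ 16 * K ^ 3 * max (b ^ 2 * k ^ 2 / Real.sqrt ε) (b ^ 3 * k ^ (5 / 2 : ℝ)) * g := by
        gcongr
        exact le_max_right _ _
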